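/- Write $\mathbf S^1=\mathbf R/\mathbf Z$, let homeomorphisms act on the right, and write $\mathrm{Supp}(f)=\{x\in\mathbf S^1 : x\cdot f\neq x\}$. For $n\ge 3$, an $n$-ring consists of connected open intervals $J_i\subset\mathbf S^1$ that cover $\mathbf S^1$ and homeomorphisms $f_i$ of $\mathbf S^1$ with $\mathrm{Supp}(f_i)=J_i$ (indices $i$ modulo $n$), such that $J_i\cap J_j=\emptyset$ whenever $i\ne j$ and $j\neq i\pm1$ modulo $n$, and such that $J_i\cap J_{i+1}$ is a nonempty connected proper subinterval of both $J_i$ and $J_{i+1}$. The $n$-ring is fast if for every $i$ the endpoint $x_i$ of $J_{i+1}$ that lies in $J_i$ satisfies $x_i\cdot f_if_{i+1}\cdots f_{i+l}\in J_{i+l+1}$ for all $1\le l\le n$. In that case $G_n=\langle f_1,\dots,f_n\rangle$ is called a fast $n$-ring group; let $H_n=[G_n,G_n]$. Thompson's group $T$ is the group of orientation preserving homeomorphisms of $\mathbf S^1$ that are piecewise linear with finitely many breakpoints, all of them in $\mathbf Z[\tfrac12]/\mathbf Z$, each linear part being of the form $t\mapsto 2^k t+d$ with $k\in\mathbf Z$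 and $d\in\mathbf Z[\tfrac12]$ modulo $\mathbf Z$. **Corollary.** There exists a finitely generated simple left orderable group, which can be taken to be $H_n=[G_n,G_n]$ for some $n\ge3$ and some fast $n$-ring group $G_n$, that admits: 1. a faithful action on the circle by $C^\infty$-diffeomorphisms; 2. a faithful action on the circle by piecewise linear homeomorphisms, each element having finitely many breakpoints; 3. an embedding into Thompson's group $T$. -/

import Mathlib

open Set
open scoped Manifold ContDiff

namespace CircleGroups

/-- The circle `ℝ / ℤ`. -/
abbrev S1 : Type := UnitAddCircle

/-- The group of all homeomorphisms of the circle `ℝ / ℤ`. -/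
abbrev HomeoS1 : Type := S1 ≃ₜ S1

/-! ### Left orderability -/

/-- A group is left orderable if it carries a total order invariant under left translations. -/
def LeftOrderable (G : Type*) [Group G] : Prop :=
  ∃ r : LinearOrder G, ∀ a b c : G, r.lt a b → r.lt (c * a) (c * b)

/-! ### Piecewise linear homeomorphisms and Thompson's group `T` -/

/-- A homeomorphism of `ℝ / ℤ` is piecewise linear, with finitely many breakpoints, if it has a
continuous lift to `ℝ` and there is a finite set `B` of points of the circle such that the lift is
affine on every closed interval whose interior contains no point lying over `B`. -/
def IsPiecewiseLinear (φ : HomeoS1) : Prop :=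
  ∃ F : ℝ → ℝ, Continuous F ∧ (∀ t : ℝ, φ (t : S1) = (F t : S1)) ∧
    ∃ B : Set S1, B.Finite ∧
      ∀ a b : ℝ, a < b → (∀ t ∈ Ioo a b, (t : S1) ∉ B) →
        ∃ m d : ℝ, ∀ t ∈ Icc a b, F t = m * t + d

/-- The elements of `ℤ[1/2]`. -/
def IsDyadic (x : ℝ) : Prop := ∃ (a : ℤ) (k : ℕ), x = a / 2 ^ k

/-- The defining property of the elements of Thompson's group `T`: there is an increasing lift
`F : ℝ → ℝ` (so the homeomorphism preserves orientation) which is affine off finitely many dyadic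
breakpoints of the circle, with slopes powers of two and constant terms in `ℤ[1/2]`. -/
def IsThompsonT (φ : HomeoS1) : Prop :=
  ∃ F : ℝ ≃o ℝ, (∀ t : ℝ, φ (t : S1) = (F t : S1)) ∧
    ∃ B : Set S1, B.Finite ∧ (∀ p ∈ B, ∃ x : ℝ, IsDyadic x ∧ p = (x : S1)) ∧
      ∀ a b : ℝ, a < b → (∀ t ∈ Ioo a b, (t : S1) ∉ B) →
        ∃ (n : ℤ) (d : ℝ), IsDyadic d ∧ ∀ t ∈ Icc a b, F t = (2 : ℝ) ^ n * t + d

theorem IsDyadic.add {x y : ℝ} (hx : IsDyadic x) (hy : IsDyadic y) : IsDyadic (x + y) := by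
  obtain ⟨a, k, rfl⟩ := hx
  obtain ⟨b, l, rfl⟩ := hy
  refine ⟨a * 2 ^ l + b * 2 ^ k, k + l, ?_⟩
  push_cast
  rw [pow_add]
  field_simp

theorem IsDyadic.neg {x : ℝ} (hx : IsDyadic x) : IsDyadic (-x) := by
  obtain ⟨a, k, rfl⟩ := hx
  exact ⟨-a, k, by push_cast; ring⟩

theorem IsDyadic.zpow_mul {x : ℝ} (hx : IsDyadic x) (n : ℤ) : IsDyadic ((2 : ℝ) ^ n * x) := by
  obtain ⟨a, k, rfl⟩ := hx
  obtain ⟨m, rfl | rfl⟩ := n.eq_nat_or_neg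
  · exact ⟨2 ^ m * a, k, by push_cast; rw [zpow_natCast]; ring⟩
  · refine ⟨a, m + k, ?_⟩
    rw [zpow_neg, zpow_natCast, pow_add]
    field_simp

/-- To the right of any point there is an open interval avoiding a given finite set. -/
theorem exists_gap (B : Set S1) (hB : B.Finite) (p : ℝ) :
    ∃ b : ℝ, p < b ∧ ∀ t ∈ Ioo p b, (t : S1) ∉ B := by
  have hopen : IsOpen ((B \ {(p : S1)})ᶜ) := (hB.subset sdiff_subset).isClosed.isOpen_compl
  have hcont : Continuous (fun t : ℝ => (t : S1)) := AddCircle.continuous_mk' 1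
  have hmem : (fun t : ℝ => (t : S1)) ⁻¹' ((B \ {(p : S1)})ᶜ) ∈ nhds p :=
    (hopen.preimage hcont).mem_nhds (by simp)
  obtain ⟨ε, hε, hsub⟩ := Metric.mem_nhds_iff.1 hmem
  refine ⟨p + min ε 1, by have := lt_min hε one_pos; linarith, fun t ht htB => ?_⟩
  have h1 : t - p < ε := by have := min_le_left ε 1; linarith [ht.2]
  have h2 : t - p < 1 := by have := min_le_right ε 1; linarith [ht.2]
  have h3 : 0 < t - p := by linarith [ht.1]
  have hball : t ∈ Metric.ball p ε := by
    rw [Metric.mem_ball, Real.dist_eq, abs_of_pos h3]; exact h1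
  refine hsub hball ⟨htB, ?_⟩
  intro (h : (t : S1) = (p : S1))
  have h0 : ((t - p : ℝ) : S1) = 0 := by
    rw [AddCircle.coe_sub, h, sub_self]
  obtain ⟨k, hk⟩ := (AddCircle.coe_eq_zero_iff (1 : ℝ)).1 h0
  rw [zsmul_eq_mul, mul_one] at hk
  have hk0 : (0 : ℝ) < k := by rw [hk]; exact h3
  have hk1 : (k : ℝ) < 1 := by rw [hk]; exact h2
  have hk0' : 0 < k := by exact_mod_cast hk0
  have hk1' : k < 1 := by exact_mod_cast hk1
  omega

/-- The image of a dyadic point under an increasing lift as in `IsThompsonT` is dyadic. -/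
theorem isDyadic_apply {F : ℝ → ℝ} {B : Set S1} (hB : B.Finite)
    (hF : ∀ a b : ℝ, a < b → (∀ t ∈ Ioo a b, (t : S1) ∉ B) →
        ∃ (n : ℤ) (d : ℝ), IsDyadic d ∧ ∀ t ∈ Icc a b, F t = (2 : ℝ) ^ n * t + d)
    {x : ℝ} (hx : IsDyadic x) : IsDyadic (F x) := by
  obtain ⟨b, hb, hgap⟩ := exists_gap B hB x
  obtain ⟨n, d, hd, h⟩ := hF x b hb hgap
  rw [h x ⟨le_rfl, hb.le⟩]
  exact (hx.zpow_mul n).add hd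

theorem IsThompsonT.one : IsThompsonT 1 := by
  refine ⟨OrderIso.refl ℝ, fun t => rfl, ∅, finite_empty, by simp, fun a b _ _ => ?_⟩
  exact ⟨0, 0, ⟨0, 0, by simp⟩, fun t _ => by simp⟩

theorem IsThompsonT.inv {φ : HomeoS1} (h : IsThompsonT φ) : IsThompsonT φ⁻¹ := by
  obtain ⟨F, hφ, B, hB, hdy, hF⟩ := h
  have hsymm : ∀ t : ℝ, φ⁻¹ (t : S1) = (F.symm t : S1) := by
    intro t
    rw [Homeomorph.inv_apply, Homeomorph.symm_apply_eq, hφ, OrderIso.apply_symm_apply]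
  refine ⟨F.symm, hsymm, φ '' B, hB.image _, ?_, ?_⟩
  · rintro _ ⟨p, hp, rfl⟩
    obtain ⟨x, hx, rfl⟩ := hdy p hp
    exact ⟨F x, isDyadic_apply hB hF hx, hφ x⟩
  · intro a b hab hfree
    obtain ⟨n, d, hd, h⟩ := hF (F.symm a) (F.symm b) (F.symm.lt_iff_lt.2 hab) (by
      intro t ht htB
      refine hfree (F t) ⟨?_, ?_⟩ ⟨t, htB, hφ t⟩
      · rw [← F.symm.lt_iff_lt, F.symm_apply_apply]; exact ht.1
      · rw [← F.symm.lt_iff_lt, F.symm_apply_apply]; exact ht.2)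
    refine ⟨-n, -((2 : ℝ) ^ (-n) * d), (hd.zpow_mul _).neg, fun t ht => ?_⟩
    have h1 := h (F.symm t) ⟨F.symm.le_iff_le.2 ht.1, F.symm.le_iff_le.2 ht.2⟩
    rw [F.apply_symm_apply] at h1
    have h2 : (2 : ℝ) ^ (-n) * (2 : ℝ) ^ n = 1 := by
      rw [← zpow_add₀ two_ne_zero]; simp
    have h3 : (2 : ℝ) ^ (-n) * t = F.symm t + (2 : ℝ) ^ (-n) * d := by
      calc (2 : ℝ) ^ (-n) * t = (2 : ℝ) ^ (-n) * ((2 : ℝ) ^ n * F.symm t + d) := by rw [← h1]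
        _ = ((2 : ℝ) ^ (-n) * (2 : ℝ) ^ n) * F.symm t + (2 : ℝ) ^ (-n) * d := by ring
        _ = F.symm t + (2 : ℝ) ^ (-n) * d := by rw [h2, one_mul]
    linarith

theorem IsThompsonT.mul {φ ψ : HomeoS1} (hφ : IsThompsonT φ) (hψ : IsThompsonT ψ) :
    IsThompsonT (φ * ψ) := by
  have hψi := hψ.inv
  obtain ⟨F, hF, B, hB, hBd, hFa⟩ := hφ
  obtain ⟨G, hG, C, hC, hCd, hGa⟩ := hψ
  obtain ⟨K, hK, D, hD, _, hKa⟩ := hψi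
  refine ⟨G.trans F, fun t => ?_, C ∪ ⇑ψ⁻¹ '' B, hC.union (hB.image _), ?_, ?_⟩
  · rw [Homeomorph.mul_apply, hG, hF]; rfl
  · rintro p (hp | ⟨q, hq, rfl⟩)
    · exact hCd p hp
    · obtain ⟨x, hx, rfl⟩ := hBd q hq
      exact ⟨K x, isDyadic_apply hD hKa hx, hK x⟩
  · intro a b hab hfree
    obtain ⟨n, d, hd, h⟩ := hGa a b hab (fun t ht htC => hfree t ht (Or.inl htC))
    obtain ⟨m, e, he, h'⟩ := hFa (G a) (G b) (G.lt_iff_lt.2 hab) (by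
      intro s hs hsB
      refine hfree (G.symm s) ⟨?_, ?_⟩ (Or.inr ⟨(s : S1), hsB, ?_⟩)
      · rw [← G.lt_iff_lt, G.apply_symm_apply]; exact hs.1
      · rw [← G.lt_iff_lt, G.apply_symm_apply]; exact hs.2
      · rw [Homeomorph.inv_apply, Homeomorph.symm_apply_eq, hG, G.apply_symm_apply])
    refine ⟨m + n, (2 : ℝ) ^ m * d + e, (hd.zpow_mul m).add he, fun t ht => ?_⟩
    have h1 := h' (G t) ⟨G.le_iff_le.2 ht.1, G.le_iff_le.2 ht.2⟩
    change F (G t) = _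
    rw [h1, h t ht, zpow_add₀ two_ne_zero]
    ring

/-- Thompson's group `T`, as a group of homeomorphisms of the circle. -/
def thompsonT : Subgroup HomeoS1 where
  carrier := {φ | IsThompsonT φ}
  mul_mem' := IsThompsonT.mul
  one_mem' := IsThompsonT.one
  inv_mem' := IsThompsonT.inv

/-! ### Smooth diffeomorphisms -/

/-- A homeomorphism of the unit circle (with its standard smooth structure) is a
`C^∞`-diffeomorphism if it and its inverse are smooth. -/
def IsSmoothDiffeo (φ : Circle ≃ₜ Circle) : Prop :=
  ContMDiff (𝓡 1) (𝓡 1) ∞ φ ∧ ContMDiff (𝓡 1) (𝓡 1) ∞ φ.symm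

/-! ### Fast ring groups -/

/-- The point `x · f_i f_{i+1} ⋯ f_{i+l}`: apply `f_i` first, then `f_{i+1}`, and so on. -/
def ringOrbit {n : ℕ} (f : ZMod n → HomeoS1) (i : ZMod n) (x : S1) : ℕ → S1
  | 0 => f i x
  | l + 1 => f (i + ((l + 1 : ℕ) : ZMod n)) (ringOrbit f i x l)

/-- A fast `n`-ring of intervals `J i` and homeomorphisms `f i` of the circle, with indices
modulo `n`. It is meant for `n ≥ 3`; in that case the last condition concerns, for each `i`, the
unique endpoint `x` of `J (i + 1)` that lies in `J i`. -/
structure IsFastRing {n : ℕ} (J : ZMod n → Set S1) (f : ZMod n → HomeoS1) : Prop where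
  isOpen : ∀ i, IsOpen (J i)
  isConnected : ∀ i, IsConnected (J i)
  cover : ⋃ i, J i = univ
  disjoint : ∀ i j, i ≠ j → j ≠ i + 1 → i ≠ j + 1 → Disjoint (J i) (J j)
  overlap_connected : ∀ i, IsConnected (J i ∩ J (i + 1))
  overlap_proper_left : ∀ i, J i ∩ J (i + 1) ≠ J i
  overlap_proper_right : ∀ i, J i ∩ J (i + 1) ≠ J (i + 1)
  support : ∀ i, J i = {x | f i x ≠ x}
  fast : ∀ i, ∀ x ∈ frontier (J (i + 1)) ∩ J i, ∀ l : ℕ, 1 ≤ l → l ≤ n →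
    ringOrbit f i x l ∈ J (i + ((l + 1 : ℕ) : ZMod n))

/-- The group generated by the homeomorphisms of a ring. -/
def ringGroup {n : ℕ} (f : ZMod n → HomeoS1) : Subgroup HomeoS1 :=
  Subgroup.closure (range f)

/-- The derived subgroup of the group generated by the homeomorphisms of a ring. -/
def derivedRingGroup {n : ℕ} (f : ZMod n → HomeoS1) : Subgroup HomeoS1 :=
  ⁅ringGroup f, ringGroup f⁆

end CircleGroups

/-!
The proof exhibits one ring with `n = 4` and studies it through a combinatorial coding.

Let `F` be an increasing homeomorphism of the line that commutes with the translation by `1`, is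
the identity on `[1/2, 1]`, pushes `(0, 1/2)` to the right, and moves some point `τ < 1/4` by
exactly `1/4` (`RingTemplate`). Its conjugates by the translations by `i/4` induce
homeomorphisms `f i` of the circle supported in the arcs `(i/4, i/4 + 1/2)`. With
`a i = i/4` and `t i = i/4 + τ`, the circle is cut into the eight cells `[a i, t i)` and
`[t i, a (i+1))`, and `f i` maps `[a i, t i)` onto `[a i, t (i+1))` and `[t i, a (i+2))` onto
`[t (i+1), a (i+2))`. These transition rules (`RingCoding`) imply that the ring is fast, and
they carry most of the argument. Write `G` for the group generated and `H` for its derived subgroup.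

* `H` is finitely generated. The complement of any cell can be moved into any other cell
  (`RingCoding.exists_compl_into_cell`), so off a cell every element of `G` agrees with an element
  of `H` (`RingCoding.exists_agree`). Hence the conjugate by a generator of an element that fixes
  a cell is its conjugate by one of finitely many elements of `H`, and these together with
  the commutators of the generators generate a subgroup normalized by `G`.

* `H` is simple, by Higman's commutator argument, as soon as every nontrivial element of `G`
  displaces a translate of a cell (`RingCoding.Displaces`). This holds if on each cell `f i` or `(f i)⁻¹`
  expands lengths, for then arbitrarily small arcs are mapped onto sets containing a cell.

* `G` depends only on the transition rules (`RingCoding.exists_injective_hom`): a word acts on the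
  points with a given itinerary under the expanding map `E` (equal to `f i` or to `(f i)⁻¹` on each
  cell) by a formula `E^k (w x) = E^m x` with `k` and `m` read off from the itinerary.

A piecewise linear template with dyadic breakpoints and slopes powers of two is expanding and gives
`G ≤ T`. By the third point its group is isomorphic to the group generated by the lifts of the
`f i` to the line, which obey the same rules, so it is left orderable; and to the group
obtained from a smooth template, which acts by diffeomorphisms.
-/

namespace CircleGroups

open scoped commutatorElement

/-! ### Codings of rings of four homeomorphisms -/

/-- A coding of the action on `X` of the elements `f i`: a partition of `X` into eight cells, given
by the map `c`, together with the rules by which the `f i` move the cells. The cells `(i, false)`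
and `(i, true)` stand for the arcs `[a i, t i)` and `[t i, a (i + 1))` in cyclic order, and `f i`
maps `[a i, t i)` onto `[a i, t (i + 1))` and `[t i, a (i + 2))` onto `[t (i + 1), a (i + 2))`. -/
structure RingCoding {Γ X : Type*} [Group Γ] [MulAction Γ X]
    (f : ZMod 4 → Γ) (c : X → ZMod 4 × Bool) : Prop where
  surjective : Function.Surjective c
  smul_low : ∀ i x, c x = (i, false) →
    c (f i • x) = (i, false) ∨ c (f i • x) = (i, true) ∨ c (f i • x) = (i + 1, false)
  smul_high : ∀ i x, c x = (i, true) ∨ c x = (i + 1, false) ∨ c x = (i + 1, true) →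
    c (f i • x) = (i + 1, true)
  smul_off : ∀ i x, (c x).1 ≠ i → (c x).1 ≠ i + 1 → f i • x = x

namespace RingCoding

variable {Γ X : Type*} [Group Γ] [MulAction Γ X] {f : ZMod 4 → Γ} {c : X → ZMod 4 × Bool}

/-- Relative to `f i`, a cell is the one on which `f i` expands, one of the three that `f i`
contracts into `(i + 1, true)`, or one that `f i` fixes. -/
theorem cell_cases (i : ZMod 4) (p : ZMod 4 × Bool) :
    p = (i, false) ∨ (p = (i, true) ∨ p = (i + 1, false) ∨ p = (i + 1, true)) ∨
      (p.1 ≠ i ∧ p.1 ≠ i + 1) := by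
  obtain ⟨q, b⟩ := p
  decide +revert

theorem inv_smul_off (h : RingCoding f c) (i : ZMod 4) (x : X) (h1 : (c x).1 ≠ i)
    (h2 : (c x).1 ≠ i + 1) : (f i)⁻¹ • x = x := by
  rw [inv_smul_eq_iff, h.smul_off i x h1 h2]

theorem inv_smul_low (h : RingCoding f c) (i : ZMod 4) (x : X)
    (hx : c x = (i, false) ∨ c x = (i, true) ∨ c x = (i + 1, false)) :
    c ((f i)⁻¹ • x) = (i, false) := by
  rcases cell_cases i (c ((f i)⁻¹ • x)) with h1 | h1 | h1
  · exact h1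
  · have h2 := h.smul_high i _ h1
    rw [smul_inv_smul] at h2
    rw [h2] at hx
    simp at hx
    exact absurd hx (by decide)
  · have h2 := h.smul_off i _ h1.1 h1.2
    rw [smul_inv_smul] at h2
    rw [← h2] at h1
    rcases hx with hx | hx | hx <;> simp [hx] at h1

theorem inv_smul_high (h : RingCoding f c) (i : ZMod 4) (x : X) (hx : c x = (i + 1, true)) :
    c ((f i)⁻¹ • x) = (i, true) ∨ c ((f i)⁻¹ • x) = (i + 1, false) ∨
      c ((f i)⁻¹ • x) = (i + 1, true) := by
  rcases cell_cases i (c ((f i)⁻¹ • x)) with h1 | h1 | h1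
  · have h2 := h.smul_low i _ h1
    rw [smul_inv_smul, hx] at h2
    simp at h2
    exact absurd h2 (by decide)
  · exact h1
  · have h2 := h.smul_off i _ h1.1 h1.2
    rw [smul_inv_smul] at h2
    rw [← h2, hx] at h1
    simp at h1

/-! ### Extreme proximality on cells -/

/-- The group generated by the `f i`. -/
abbrev gp (f : ZMod 4 → Γ) : Subgroup Γ := Subgroup.closure (range f)

theorem mem_gp (i : ZMod 4) : f i ∈ gp f := Subgroup.subset_closure ⟨i, rfl⟩

/-- The cells can be moved into each other: `f i` moves `(i, true)` into `(i + 1, true)`, and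
`f (i - 1)` and `(f i)⁻¹` move each of the two cells of index `i` into the other. -/
theorem exists_cell_into_cell (h : RingCoding f c) (p q : ZMod 4 × Bool) :
    ∃ g ∈ gp f, ∀ x, c x = p → c (g • x) = q := by
  have trans : ∀ {p q r : ZMod 4 × Bool}, (∃ g ∈ gp f, ∀ x, c x = p → c (g • x) = q) →
      (∃ g ∈ gp f, ∀ x, c x = q → c (g • x) = r) → ∃ g ∈ gp f, ∀ x, c x = p → c (g • x) = r := by
    rintro p q r ⟨g, hg, h1⟩ ⟨k, hk, h2⟩
    exact ⟨k * g, mul_mem hk hg, fun x hx => by rw [mul_smul]; exact h2 _ (h1 _ hx)⟩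
  have next : ∀ i : ZMod 4, ∃ g ∈ gp f, ∀ x, c x = (i, true) → c (g • x) = (i + 1, true) :=
    fun i => ⟨f i, mem_gp i, fun x hx => h.smul_high i x (Or.inl hx)⟩
  have up : ∀ i b, ∃ g ∈ gp f, ∀ x, c x = (i, b) → c (g • x) = (i, true) := by
    intro i b
    refine ⟨f (i - 1), mem_gp _, fun x hx => ?_⟩
    have := h.smul_high (i - 1) x
    rw [sub_add_cancel] at this
    cases b <;> exact this (by simp [hx])
  have down : ∀ i b, ∃ g ∈ gp f, ∀ x, c x = (i, true) → c (g • x) = (i, b) := by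
    intro i b
    cases b
    · exact ⟨(f i)⁻¹, inv_mem (mem_gp i), fun x hx => h.inv_smul_low i x (by simp [hx])⟩
    · exact ⟨1, one_mem _, fun x hx => by simpa using hx⟩
  have shift : ∀ (n : ℕ) (i : ZMod 4), ∃ g ∈ gp f, ∀ x, c x = (i, true) →
      c (g • x) = (i + n, true) := by
    intro n
    induction n with
    | zero => intro i; exact ⟨1, one_mem _, fun x hx => by simpa using hx⟩
    | succ n ih =>
      intro i
      have := trans (ih i) (next _)
      rwa [add_assoc, ← Nat.cast_succ] at this
  obtain ⟨i, b⟩ := p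
  obtain ⟨j, b'⟩ := q
  have := shift (j - i).val i
  rw [ZMod.natCast_zmod_val, add_sub_cancel] at this
  exact trans (up i b) (trans this (down j b'))

/-- The complement of any cell can be moved into some cell: going once around the ring
pushes everything outside the cell into the last cell reached. -/
theorem exists_compl_into_some_cell (h : RingCoding f c) (p : ZMod 4 × Bool) :
    ∃ q, ∃ g ∈ gp f, ∀ x, c x ≠ p → c (g • x) = q := by
  have four : ∀ i j : ZMod 4, j = i ∨ j = i + 1 ∨ j = i + 2 ∨ j = i + 3 := by decide
  obtain ⟨i, b⟩ := p
  have s1 : ∀ i : ZMod 4, i + 1 + 1 = i + 2 := by decide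
  have s2 : ∀ i : ZMod 4, i + 2 + 1 = i + 3 := by decide
  have s3 : ∀ i : ZMod 4, i + 3 + 1 = i := by decide
  have e9 : ∀ i : ZMod 4, i + 1 ≠ i + 3 := by decide
  have e10 : ∀ i : ZMod 4, i + 1 ≠ i + 2 := by decide
  cases b
  · refine ⟨(i + 3, true), f (i + 2) * (f (i + 1) * f i),
      mul_mem (mem_gp _) (mul_mem (mem_gp _) (mem_gp _)), fun x hx => ?_⟩
    rw [mul_smul, mul_smul]
    have h1 : c (f i • x) = (i + 1, true) ∨ (c (f i • x)).1 = i + 2 ∨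
        (c (f i • x)).1 = i + 3 := by
      rcases cell_cases i (c x) with h1 | h1 | h1
      · exact absurd h1 hx
      · exact Or.inl (h.smul_high i x h1)
      · rw [h.smul_off i x h1.1 h1.2]
        have := four i (c x).1
        tauto
    generalize f i • x = y at h1 ⊢
    have h2 : c (f (i + 1) • y) = (i + 2, true) ∨ (c (f (i + 1) • y)).1 = i + 3 := by
      rcases cell_cases (i + 1) (c y) with h2 | h2 | h2
      · rw [h2] at h1; simp [e9, e10] at h1
      · left
        rw [h.smul_high (i + 1) y h2, s1]
      · right
        rw [h.smul_off _ _ h2.1 h2.2]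
        rw [s1] at h2
        rcases h1 with h1 | h1 | h1
        · rw [h1] at h2; simp at h2
        · exact absurd h1 h2.2
        · exact h1
    generalize f (i + 1) • y = z at h2 ⊢
    rcases cell_cases (i + 2) (c z) with h3 | h3 | h3
    · rw [h3] at h2; simp at h2
      exact absurd h2 (by decide)
    · rw [h.smul_high (i + 2) z h3, s2]
    · rw [s2] at h3
      rcases h2 with h2 | h2
      · rw [h2] at h3; simp at h3
      · exact absurd h2 h3.2
  · refine ⟨(i + 1, false), (f (i + 1))⁻¹ * ((f (i + 2))⁻¹ * (f (i + 3))⁻¹),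
      mul_mem (inv_mem (mem_gp _)) (mul_mem (inv_mem (mem_gp _)) (inv_mem (mem_gp _))),
      fun x hx => ?_⟩
    rw [mul_smul, mul_smul]
    have h1 : c ((f (i + 3))⁻¹ • x) = (i + 3, false) ∨ (c ((f (i + 3))⁻¹ • x)).1 = i + 1 ∨
        (c ((f (i + 3))⁻¹ • x)).1 = i + 2 := by
      have hl := h.inv_smul_low (i + 3) x
      have ho := h.inv_smul_off (i + 3) x
      rw [s3] at hl ho
      rcases cell_cases (i + 3) (c x) with h1 | h1 | h1
      · exact Or.inl (hl (Or.inl h1))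
      · rw [s3] at h1
        left; apply hl; tauto
      · rw [s3] at h1
        rw [ho h1.1 h1.2]
        have := four i (c x).1
        tauto
    generalize (f (i + 3))⁻¹ • x = y at h1 ⊢
    have h2 : c ((f (i + 2))⁻¹ • y) = (i + 2, false) ∨ (c ((f (i + 2))⁻¹ • y)).1 = i + 1 := by
      have hl := h.inv_smul_low (i + 2) y
      have ho := h.inv_smul_off (i + 2) y
      rw [s2] at hl ho
      rcases cell_cases (i + 2) (c y) with h2 | h2 | h2
      · exact Or.inl (hl (Or.inl h2))
      · rw [s2] at h2
        rcases h2 with h2 | h2 | h2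
        · left; apply hl; tauto
        · left; apply hl; tauto
        · rw [h2] at h1; simp at h1; exact absurd h1 (by decide)
      · rw [s2] at h2
        rw [ho h2.1 h2.2]
        right
        rcases h1 with h1 | h1 | h1
        · rw [h1] at h2; simp at h2
        · exact h1
        · exact absurd h1 h2.1
    generalize (f (i + 2))⁻¹ • y = z at h2 ⊢
    have hl := h.inv_smul_low (i + 1) z
    rw [s1] at hl
    apply hl
    rcases h2 with h2 | h2
    · simp [h2]
    · rcases hz : c z with ⟨p, b⟩
      rw [hz] at h2
      cases b <;> simp_all

/-- Extreme proximality: the complement of any cell can be moved into any cell. -/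
theorem exists_compl_into_cell (h : RingCoding f c) (p q : ZMod 4 × Bool) :
    ∃ g ∈ gp f, ∀ x, c x ≠ p → c (g • x) = q := by
  obtain ⟨r, g, hg, h1⟩ := h.exists_compl_into_some_cell p
  obtain ⟨k, hk, h2⟩ := h.exists_cell_into_cell r q
  exact ⟨k * g, mul_mem hk hg, fun x hx => by rw [mul_smul]; exact h2 _ (h1 x hx)⟩

end RingCoding

/-! ### Supports and commutators -/

section Support

variable {Γ X : Type*} [Group Γ] [MulAction Γ X]

theorem smul_mem_of_support {a : Γ} {D : Set X} (ha : ∀ x ∉ D, a • x = x) {x : X} (hx : x ∈ D) :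
    a • x ∈ D := by
  by_contra h
  have := ha _ h
  rw [smul_left_cancel_iff] at this
  rw [this] at h
  exact h hx

variable [FaithfulSMul Γ X]

theorem commute_of_support {a b : Γ} {D E : Set X} (hDE : Disjoint D E)
    (ha : ∀ x ∉ D, a • x = x) (hb : ∀ x ∉ E, b • x = x) : a * b = b * a := by
  refine FaithfulSMul.eq_of_smul_eq_smul fun x : X => ?_
  rw [mul_smul, mul_smul]
  by_cases hx : x ∈ D
  · rw [hb x (disjoint_left.1 hDE hx), hb _ (disjoint_left.1 hDE (smul_mem_of_support ha hx))]
  · rw [ha x hx]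
    by_cases hx' : x ∈ E
    · rw [ha _ (disjoint_right.1 hDE (smul_mem_of_support hb hx'))]
    · rw [hb x hx', ha x hx]

/-- If `g ∈ N` moves `D` off itself, then `N` contains the commutators of the elements supported
in `D` that normalize `N`: replacing `a` by `a * (g * a⁻¹ * g⁻¹) ∈ N` does not change `⁅a, b⁆`. -/
theorem commutator_mem_of_displaced {N : Subgroup Γ} {g a b : Γ} {D : Set X} (hg : g ∈ N)
    (hD : ∀ x ∈ D, g • x ∉ D) (haN : ∀ n ∈ N, a * n * a⁻¹ ∈ N) (hbN : ∀ n ∈ N, b * n * b⁻¹ ∈ N)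
    (ha : ∀ x ∉ D, a • x = x) (hb : ∀ x ∉ D, b • x = x) : ⁅a, b⁆ ∈ N := by
  have hcomm : (g * a⁻¹ * g⁻¹) * b = b * (g * a⁻¹ * g⁻¹) := by
    refine commute_of_support (D := {x | g⁻¹ • x ∈ D}) (E := D) ?_ ?_ hb
    · rw [disjoint_left]
      intro x hx hx'
      have := hD _ hx
      rw [smul_inv_smul] at this
      exact this hx'
    · intro x hx
      have : a⁻¹ • g⁻¹ • x = g⁻¹ • x := by rw [inv_smul_eq_iff, ha _ hx]
      rw [mul_smul, mul_smul, this, smul_inv_smul]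
  have hmem : a * (g * a⁻¹ * g⁻¹) ∈ N := by
    have := mul_mem (haN g hg) (inv_mem hg)
    simpa only [mul_assoc] using this
  have h2 : ⁅a * (g * a⁻¹ * g⁻¹), b⁆ ∈ N := by
    have := mul_mem hmem (hbN _ (inv_mem hmem))
    rw [commutatorElement_def]
    simpa only [mul_assoc] using this
  have h3 : ⁅a * (g * a⁻¹ * g⁻¹), b⁆ = ⁅a, b⁆ := by
    generalize g * a⁻¹ * g⁻¹ = z at hcomm
    rw [commutatorElement_def, commutatorElement_def, mul_assoc a z b, hcomm]
    group
  exact h3 ▸ h2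

end Support

/-- The derived subgroup of a group generated by `f` is contained in every subgroup that it
normalizes and that contains the commutators of the generators. -/
theorem commutator_closure_le {Γ ι : Type*} [Group Γ] {f : ι → Γ} {N : Subgroup Γ}
    (hN : ∀ g ∈ Subgroup.closure (range f), ∀ n ∈ N, g * n * g⁻¹ ∈ N)
    (hf : ∀ i j, ⁅f i, f j⁆ ∈ N) :
    ⁅Subgroup.closure (range f), Subgroup.closure (range f)⁆ ≤ N := by
  have key : ∀ a : Γ, (∀ j, ⁅a, f j⁆ ∈ N) → ∀ b ∈ Subgroup.closure (range f), ⁅a, b⁆ ∈ N := by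
    intro a ha b hb
    induction hb using Subgroup.closure_induction with
    | mem x hx => obtain ⟨j, rfl⟩ := hx; exact ha j
    | one => simp
    | mul x y hx hy h1 h2 =>
      have : ⁅a, x * y⁆ = ⁅a, x⁆ * (x * ⁅a, y⁆ * x⁻¹) := by
        simp only [commutatorElement_def]; group
      rw [this]
      exact mul_mem h1 (hN x hx _ h2)
    | inv x hx h1 =>
      have : ⁅a, x⁻¹⁆ = x⁻¹ * ⁅a, x⁆⁻¹ * x⁻¹⁻¹ := by
        simp only [commutatorElement_def]; group
      rw [this]
      exact hN _ (inv_mem hx) _ (inv_mem h1)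
  rw [Subgroup.commutator_le]
  refine fun a ha b hb => key a (fun j => ?_) b hb
  rw [← inv_mem_iff, commutatorElement_inv]
  exact key (f j) (fun i => hf j i) a ha

namespace RingCoding

variable {Γ X : Type*} [Group Γ] [MulAction Γ X] {f : ZMod 4 → Γ} {c : X → ZMod 4 × Bool}

/-- The cells with index `i + 2` or `i + 3` are fixed pointwise by `f i`. -/
theorem smul_fix (h : RingCoding f c) (i : ZMod 4) (b : Bool) (x : X)
    (hx : c x = (i + 2, b) ∨ c x = (i + 3, b)) : f i • x = x := by
  have e1 : ∀ i : ZMod 4, i + 2 ≠ i ∧ i + 2 ≠ i + 1 ∧ i + 3 ≠ i ∧ i + 3 ≠ i + 1 := by decide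
  obtain ⟨h1, h2, h3, h4⟩ := e1 i
  rcases hx with hx | hx
  · exact h.smul_off i x (by rw [hx]; exact h1) (by rw [hx]; exact h2)
  · exact h.smul_off i x (by rw [hx]; exact h3) (by rw [hx]; exact h4)

/-- Off any translate of a cell, every element of the group agrees with some element of its
derived subgroup. For a generator `s` this element is `s * (k * s⁻¹ * k⁻¹)`, where `k` squeezes
the support of `s` into the translate. -/
theorem exists_agree (h : RingCoding f c) {g : Γ} (hg : g ∈ gp f) :
    ∀ p ∈ gp f, ∀ q, ∃ k ∈ ⁅gp f, gp f⁆, ∀ x, c (p • x) ≠ q → k • x = g • x := by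
  have aux : ∀ s ∈ gp f, ∀ r, (∀ x, c x = r → s • x = x) →
      ∀ p ∈ gp f, ∀ q, ∃ k ∈ ⁅gp f, gp f⁆, ∀ x, c (p • x) ≠ q → k • x = s • x := by
    intro s hs r hr p hp q
    obtain ⟨k, hk, hkq⟩ := h.exists_compl_into_cell r q
    refine ⟨⁅s, p⁻¹ * k⁆,
      Subgroup.commutator_mem_commutator hs (mul_mem (inv_mem hp) hk), fun x hx => ?_⟩
    have h1 : c (k⁻¹ • p • x) = r := by
      by_contra h1
      have := hkq _ h1
      rw [smul_inv_smul] at this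
      exact hx this
    have h2 : s⁻¹ • k⁻¹ • p • x = k⁻¹ • p • x := by rw [inv_smul_eq_iff, hr _ h1]
    simp only [commutatorElement_def, mul_inv_rev, inv_inv, mul_smul, h2, smul_inv_smul,
      inv_smul_smul]
  induction hg using Subgroup.closure_induction with
  | mem s hs =>
    obtain ⟨i, rfl⟩ := hs
    exact aux _ (mem_gp i) (i + 2, false) fun x hx => h.smul_fix i false x (Or.inl hx)
  | one => exact fun p _ q => ⟨1, one_mem _, fun x _ => rfl⟩
  | mul a b ha hb h1 h2 =>
    intro p hp q
    obtain ⟨k, hk, hkb⟩ := h2 p hp q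
    obtain ⟨l, hl, hla⟩ := h1 (p * b⁻¹) (mul_mem hp (inv_mem hb)) q
    refine ⟨l * k, mul_mem hl hk, fun x hx => ?_⟩
    rw [mul_smul, mul_smul, hkb x hx, hla]
    rwa [mul_smul, inv_smul_smul]
  | inv a ha h1 =>
    intro p hp q
    obtain ⟨k, hk, hka⟩ := h1 (p * a) (mul_mem hp ha) q
    refine ⟨k⁻¹, inv_mem hk, fun x hx => ?_⟩
    have := hka (a⁻¹ • x) (by rwa [mul_smul, smul_inv_smul])
    rw [inv_smul_eq_iff, this, smul_inv_smul]

theorem commutator_ne_one (h : RingCoding f c) (i : ZMod 4) : ⁅f i, f (i + 1)⁆ ≠ 1 := by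
  rw [Ne, commutatorElement_eq_one_iff_mul_comm]
  intro hc
  obtain ⟨x, hx⟩ := h.surjective (i + 1, false)
  have e1 : ∀ i : ZMod 4, i + 1 + 1 ≠ i ∧ i + 1 + 1 ≠ i + 1 := by decide
  have h1 : c ((f (i + 1) * f i) • x) = (i + 1 + 1, true) := by
    rw [mul_smul]
    exact h.smul_high (i + 1) _ (Or.inl (h.smul_high i x (Or.inr (Or.inl hx))))
  rw [← hc, mul_smul] at h1
  rcases h.smul_low (i + 1) x hx with h2 | h2 | h2
  · rw [h.smul_high i _ (Or.inr (Or.inl h2))] at h1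
    exact (e1 i).2 (congrArg Prod.fst h1).symm
  · rw [h.smul_high i _ (Or.inr (Or.inr h2))] at h1
    exact (e1 i).2 (congrArg Prod.fst h1).symm
  · rw [h.smul_off i _ (by rw [h2]; exact (e1 i).1) (by rw [h2]; exact (e1 i).2), h2] at h1
    exact absurd (congrArg Prod.snd h1) (by simp)

theorem conj_mem_derived {g n : Γ} (hg : g ∈ gp f) (hn : n ∈ ⁅gp f, gp f⁆) :
    g * n * g⁻¹ ∈ ⁅gp f, gp f⁆ := by
  have h1 : ⁅g, n⁆ ∈ ⁅gp f, gp f⁆ :=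
    Subgroup.commutator_mem_commutator hg (Subgroup.commutator_le_self _ hn)
  have := mul_mem h1 hn
  rwa [commutatorElement_def, inv_mul_cancel_right] at this

/-- Every nontrivial element of the group moves some translate of a cell off itself. -/
def Displaces (f : ZMod 4 → Γ) (c : X → ZMod 4 × Bool) : Prop :=
  ∀ g ∈ gp f, g ≠ 1 → ∃ k ∈ gp f, ∃ q, ∀ x, c x = q → c ((k * g * k⁻¹) • x) ≠ q

/-- The subgroup generated by the commutators of elements of the derived subgroup that fix
pointwise a common translate of a cell. -/
def localCommutators (f : ZMod 4 → Γ) (c : X → ZMod 4 × Bool) : Subgroup Γ :=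
  Subgroup.closure {z | ∃ a ∈ ⁅gp f, gp f⁆, ∃ b ∈ ⁅gp f, gp f⁆, ∃ p ∈ gp f, ∃ q,
    (∀ x, c (p • x) = q → a • x = x ∧ b • x = x) ∧ z = ⁅a, b⁆}

theorem conj_mem_localCommutators {g : Γ} (hg : g ∈ gp f) :
    ∀ n ∈ localCommutators f c, g * n * g⁻¹ ∈ localCommutators f c := by
  intro n hn
  induction hn using Subgroup.closure_induction with
  | mem z hz =>
    obtain ⟨a, ha, b, hb, p, hp, q, hq, rfl⟩ := hz
    refine Subgroup.subset_closure ⟨g * a * g⁻¹, conj_mem_derived hg ha, g * b * g⁻¹,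
      conj_mem_derived hg hb, p * g⁻¹, mul_mem hp (inv_mem hg), q, fun x hx => ?_, ?_⟩
    · rw [mul_smul] at hx
      simp only [mul_smul, (hq _ hx).1, (hq _ hx).2, smul_inv_smul, and_self]
    · simp only [commutatorElement_def]; group
  | one => simp
  | mul x y _ _ hx hy =>
    have : g * (x * y) * g⁻¹ = (g * x * g⁻¹) * (g * y * g⁻¹) := by group
    rw [this]
    exact mul_mem hx hy
  | inv x _ hx =>
    have : g * x⁻¹ * g⁻¹ = (g * x * g⁻¹)⁻¹ := by group
    rw [this]
    exact inv_mem hx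

variable [FaithfulSMul Γ X]

theorem commutator_add_two (h : RingCoding f c) (i : ZMod 4) : ⁅f i, f (i + 2)⁆ = 1 := by
  rw [commutatorElement_eq_one_iff_mul_comm]
  refine commute_of_support (D := {x | (c x).1 = i ∨ (c x).1 = i + 1})
    (E := {x | (c x).1 = i + 2 ∨ (c x).1 = i + 2 + 1}) ?_ ?_ ?_
  · rw [disjoint_left]
    intro x
    simp only [mem_ofPred_eq]
    generalize (c x).1 = p
    revert p i
    decide
  · intro x hx
    simp only [mem_ofPred_eq, not_or] at hx
    exact h.smul_off i x hx.1 hx.2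
  · intro x hx
    simp only [mem_ofPred_eq, not_or] at hx
    exact h.smul_off (i + 2) x hx.1 hx.2

/-- Two of the four generators commute or fix a common cell pointwise. -/
theorem commutator_eq_one_or_fix (h : RingCoding f c) (i j : ZMod 4) :
    ⁅f i, f j⁆ = 1 ∨ ∃ q, ∀ x, c x = q → f i • x = x ∧ f j • x = x := by
  have four : ∀ i j : ZMod 4, j = i ∨ j = i + 1 ∨ j = i + 2 ∨ i = j + 1 := by decide
  have e : ∀ i : ZMod 4, i + 3 = i + 1 + 2 := by decide
  rcases four i j with rfl | rfl | rfl | rfl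
  · left; simp
  · refine Or.inr ⟨(i + 3, false), fun x hx => ⟨h.smul_fix i false x (Or.inr hx), ?_⟩⟩
    exact h.smul_fix (i + 1) false x (Or.inl (by rw [hx, e]))
  · exact Or.inl (h.commutator_add_two i)
  · refine Or.inr ⟨(j + 3, false), fun x hx => ⟨?_, h.smul_fix j false x (Or.inr hx)⟩⟩
    exact h.smul_fix (j + 1) false x (Or.inl (by rw [hx, e]))

/-! ### Finite generation of the derived subgroup -/

/-- The derived subgroup is generated by the commutators of the generators together with finitely
many elements that act like the generators off the various cells: conjugating by a generator an
element that fixes a cell amounts to conjugating by one of the latter. -/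
theorem fg_derived (h : RingCoding f c) : Group.FG ↥⁅gp f, gp f⁆ := by
  let s : ZMod 4 × Bool → Γ := fun a => if a.2 then f a.1 else (f a.1)⁻¹
  have hs : ∀ a, s a ∈ gp f := by
    rintro ⟨i, b⟩
    cases b
    · exact inv_mem (mem_gp i)
    · exact mem_gp i
  have hsfix : ∀ a b x, c x = (a.1 + 2, b) → s a • x = x := by
    rintro ⟨i, b⟩ b' x hx
    have := h.smul_fix i b' x (Or.inl hx)
    cases b
    · exact inv_smul_eq_iff.2 this.symm
    · exact this
  choose! k hkH hk using fun (a : ZMod 4 × Bool) (q : ZMod 4 × Bool) =>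
    h.exists_agree (hs a) 1 (one_mem _) q
  simp only [one_smul] at hk
  let S : Set Γ := range (fun z : (ZMod 4 × Bool) × (ZMod 4 × Bool) => k z.1 z.2) ∪
    range (fun z : ZMod 4 × ZMod 4 => ⁅f z.1, f z.2⁆)
  have hSfin : S.Finite := (finite_range _).union (finite_range _)
  have hSfix : ∀ z ∈ S, ∃ q, ∀ x, c x = q → z • x = x := by
    rintro z (⟨⟨a, q⟩, rfl⟩ | ⟨⟨i, j⟩, rfl⟩)
    · -- of the two cells `(a.1 + 2, _)` fixed by `s a`, one differs from `q`
      obtain ⟨b, hb⟩ : ∃ b, (a.1 + 2, b) ≠ q := ⟨!q.2, fun hq => by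
        have := congrArg Prod.snd hq
        revert this; simp⟩
      refine ⟨(a.1 + 2, b), fun x hx => ?_⟩
      change k a q • x = x
      rw [hk a q x (by rwa [hx]), hsfix a b x hx]
    · change ∃ q, ∀ x, c x = q → ⁅f i, f j⁆ • x = x
      rcases h.commutator_eq_one_or_fix i j with h1 | ⟨q, hq⟩
      · exact ⟨(0, false), fun x _ => by rw [h1, one_smul]⟩
      · refine ⟨q, fun x hx => ?_⟩
        obtain ⟨h1, h2⟩ := hq x hx
        have h1' : (f i)⁻¹ • x = x := inv_smul_eq_iff.2 h1.symm
        have h2' : (f j)⁻¹ • x = x := inv_smul_eq_iff.2 h2.symm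
        simp only [commutatorElement_def, mul_smul, h1, h2, h1', h2']
  have hconj : ∀ a, ∀ z ∈ Subgroup.closure S, s a * z * (s a)⁻¹ ∈ Subgroup.closure S := by
    intro a z hz
    induction hz using Subgroup.closure_induction with
    | mem z hz =>
      obtain ⟨q, hq⟩ := hSfix z hz
      have hc : ((s a)⁻¹ * k a q) * z = z * ((s a)⁻¹ * k a q) := by
        refine commute_of_support (D := {x | c x = q}) (E := {x | c x ≠ q})
          disjoint_compl_right (fun x hx => ?_) (fun x hx => hq x (by simpa using hx))
        rw [mul_smul, hk a q x hx, inv_smul_smul]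
      have : s a * z * (s a)⁻¹ = k a q * z * (k a q)⁻¹ := by
        rw [eq_mul_inv_iff_mul_eq]
        calc s a * z * (s a)⁻¹ * k a q = s a * (z * ((s a)⁻¹ * k a q)) := by group
          _ = k a q * z := by rw [← hc]; group
      rw [this]
      have hkS : k a q ∈ Subgroup.closure S := Subgroup.subset_closure (Or.inl ⟨(a, q), rfl⟩)
      exact mul_mem (mul_mem hkS (Subgroup.subset_closure hz)) (inv_mem hkS)
    | one => simp
    | mul x y _ _ hx hy =>
      have : s a * (x * y) * (s a)⁻¹ = (s a * x * (s a)⁻¹) * (s a * y * (s a)⁻¹) := by group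
      rw [this]
      exact mul_mem hx hy
    | inv x _ hx =>
      have : s a * x⁻¹ * (s a)⁻¹ = (s a * x * (s a)⁻¹)⁻¹ := by group
      rw [this]
      exact inv_mem hx
  have hnorm : ∀ g ∈ gp f, ∀ z ∈ Subgroup.closure S, g * z * g⁻¹ ∈ Subgroup.closure S := by
    intro g hg
    suffices H : (∀ z ∈ Subgroup.closure S, g * z * g⁻¹ ∈ Subgroup.closure S) ∧
        ∀ z ∈ Subgroup.closure S, g⁻¹ * z * g ∈ Subgroup.closure S from H.1
    induction hg using Subgroup.closure_induction with
    | mem g hg =>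
      obtain ⟨i, rfl⟩ := hg
      refine ⟨fun z hz => hconj (i, true) z hz, fun z hz => ?_⟩
      have := hconj (i, false) z hz
      simpa [s] using this
    | one => simp
    | mul a b _ _ ha hb =>
      refine ⟨fun z hz => ?_, fun z hz => ?_⟩
      · have := ha.1 _ (hb.1 z hz)
        simpa only [mul_inv_rev, mul_assoc] using this
      · have := hb.2 _ (ha.2 z hz)
        simpa only [mul_inv_rev, mul_assoc] using this
    | inv a _ ha => exact ⟨fun z hz => by simpa using ha.2 z hz, fun z hz => by simpa using ha.1 z hz⟩
  have hle : ⁅gp f, gp f⁆ ≤ Subgroup.closure S :=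
    commutator_closure_le hnorm fun i j => Subgroup.subset_closure (Or.inr ⟨(i, j), rfl⟩)
  have hge : Subgroup.closure S ≤ ⁅gp f, gp f⁆ := by
    rw [Subgroup.closure_le]
    rintro z (⟨⟨a, q⟩, rfl⟩ | ⟨⟨i, j⟩, rfl⟩)
    · exact hkH a q
    · exact Subgroup.commutator_mem_commutator (mem_gp i) (mem_gp j)
  rw [Group.fg_iff_subgroup_fg, Subgroup.fg_iff]
  exact ⟨S, le_antisymm hge hle, hSfin⟩

/-! ### Simplicity of the derived subgroup -/

/-- A nontrivial subgroup normalized by the group contains the derived subgroup: it contains a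
conjugate of the commutator of any two generators, with supports squeezed into a displaced cell. -/
theorem derived_le_of_normalized (h : RingCoding f c) (hd : Displaces f c) {N : Subgroup Γ}
    (hN : ∀ g ∈ gp f, ∀ n ∈ N, g * n * g⁻¹ ∈ N) {g : Γ} (hg : g ∈ gp f) (hgN : g ∈ N)
    (hg1 : g ≠ 1) : ⁅gp f, gp f⁆ ≤ N := by
  obtain ⟨k, hk, q, hq⟩ := hd g hg hg1
  refine commutator_closure_le hN fun i j => ?_
  rcases h.commutator_eq_one_or_fix i j with h1 | ⟨r, hr⟩
  · rw [h1]; exact one_mem _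
  obtain ⟨l, hl, hlq⟩ := h.exists_compl_into_cell r q
  have hsupp : ∀ s, (∀ x, c x = r → s • x = x) → ∀ x ∉ {x | c x = q},
      (l * s * l⁻¹) • x = x := by
    intro s hs x hx
    have h1 : c (l⁻¹ • x) = r := by
      by_contra h1
      have := hlq _ h1
      rw [smul_inv_smul] at this
      exact hx this
    rw [mul_smul, mul_smul, hs _ h1, smul_inv_smul]
  have hmem : ∀ i, l * f i * l⁻¹ ∈ gp f := fun i => mul_mem (mul_mem hl (mem_gp i)) (inv_mem hl)
  have h2 : ⁅l * f i * l⁻¹, l * f j * l⁻¹⁆ ∈ N :=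
    commutator_mem_of_displaced (hN k hk g hgN) (D := {x | c x = q}) hq
      (hN _ (hmem i)) (hN _ (hmem j))
      (hsupp _ fun x hx => (hr x hx).1) (hsupp _ fun x hx => (hr x hx).2)
  have h3 := hN _ (inv_mem hl) _ h2
  have h4 : l⁻¹ * ⁅l * f i * l⁻¹, l * f j * l⁻¹⁆ * l⁻¹⁻¹ = ⁅f i, f j⁆ := by
    simp only [commutatorElement_def]; group
  rwa [h4] at h3

/-- The local commutators generate a nontrivial subgroup normalized by the whole group, hence
one that contains the derived subgroup. -/
theorem derived_le_localCommutators (h : RingCoding f c) (hd : Displaces f c) :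
    ⁅gp f, gp f⁆ ≤ localCommutators f c := by
  -- `u` is a nontrivial element supported in the cell `(1, false)`; `k` acts like `f 0` there,
  -- so it moves that cell into the cell `(1, true)`; both fix the cell `(2, false)`.
  obtain ⟨l, hl, hlq⟩ := h.exists_compl_into_cell (3, false) (1, false)
  obtain ⟨k, hk, hkf⟩ := h.exists_agree (mem_gp (f := f) 0) 1 (one_mem _) (3, false)
  simp only [one_smul] at hkf
  set u := l * ⁅f 0, f (0 + 1)⁆ * l⁻¹ with hu
  have hu1 : u ≠ 1 := fun h1 => h.commutator_ne_one 0 (conj_eq_one_iff.1 h1)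
  have huH : u ∈ ⁅gp f, gp f⁆ :=
    conj_mem_derived hl (Subgroup.commutator_mem_commutator (mem_gp _) (mem_gp _))
  have husupp : ∀ x, c x ≠ (1, false) → u • x = x := by
    intro x hx
    have h1 : c (l⁻¹ • x) = (3, false) := by
      by_contra h1
      have := hlq _ h1
      rw [smul_inv_smul] at this
      exact hx this
    have h2 : ∀ i : ZMod 4, i = 0 ∨ i = 0 + 1 → f i • l⁻¹ • x = l⁻¹ • x := by
      rintro i (rfl | rfl)
      · exact h.smul_fix 0 false _ (Or.inr h1)
      · exact h.smul_fix (0 + 1) false _ (Or.inl h1)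
    have h3 := h2 0 (Or.inl rfl)
    have h4 := h2 (0 + 1) (Or.inr rfl)
    have h3' := (inv_smul_eq_iff (g := f 0)).2 h3.symm
    have h4' := (inv_smul_eq_iff (g := f (0 + 1))).2 h4.symm
    simp only [hu, commutatorElement_def, mul_smul, h3, h4, h3', h4', smul_inv_smul]
  have hmem : ⁅k, u⁆ ∈ localCommutators f c := by
    refine Subgroup.subset_closure ⟨k, hk, u, huH, 1, one_mem _, (2, false), fun x hx => ?_, rfl⟩
    rw [one_smul] at hx
    refine ⟨?_, husupp x (by rw [hx]; decide)⟩
    rw [hkf x (by rw [hx]; decide)]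
    exact h.smul_fix 0 false x (Or.inl hx)
  have hne : ⁅k, u⁆ ≠ 1 := by
    rw [Ne, commutatorElement_eq_one_iff_mul_comm]
    intro hc
    refine hu1 (FaithfulSMul.eq_of_smul_eq_smul fun x : X => ?_)
    rw [one_smul]
    by_cases hx : c x = (1, false)
    · have h1 : c (k • x) = (1, true) := by
        rw [hkf x (by rw [hx]; decide)]
        exact h.smul_high 0 x (Or.inr (Or.inl hx))
      have h2 : k • u • x = k • x := by
        rw [← mul_smul, hc, mul_smul, husupp _ (by rw [h1]; decide)]
      exact smul_left_cancel _ h2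
    · exact husupp x hx
  refine h.derived_le_of_normalized hd (fun g hg => conj_mem_localCommutators hg) ?_ hmem hne
  exact Subgroup.commutator_le_self _
    (Subgroup.commutator_mem_commutator (Subgroup.commutator_le_self _ hk)
      (Subgroup.commutator_le_self _ huH))

/-- A nontrivial subgroup of the derived subgroup that is normalized by it is the whole of it. -/
theorem derived_le_of_normalized_by_derived (h : RingCoding f c) (hd : Displaces f c)
    {N : Subgroup Γ} (hN : ∀ g ∈ ⁅gp f, gp f⁆, ∀ n ∈ N, g * n * g⁻¹ ∈ N) {g : Γ}
    (hg : g ∈ gp f) (hgN : g ∈ N) (hg1 : g ≠ 1) : ⁅gp f, gp f⁆ ≤ N := by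
  refine (h.derived_le_localCommutators hd).trans ?_
  obtain ⟨k, hk, q, hq⟩ := hd g hg hg1
  refine (Subgroup.closure_le _).2 ?_
  rintro z ⟨a, ha, b, hb, p, hp, r, hr, rfl⟩
  obtain ⟨l, hl, hlq⟩ := h.exists_compl_into_cell r q
  obtain ⟨t, ht, htl⟩ :=
    h.exists_agree (mul_mem (mul_mem (inv_mem hk) hl) hp) p hp r
  have hsupp : ∀ s, (∀ x, c (p • x) = r → s • x = x) → ∀ x ∉ {x | c (k • x) = q},
      (t * s * t⁻¹) • x = x := by
    intro s hs x hx
    have h1 : c (p • t⁻¹ • x) = r := by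
      by_contra h1
      have h2 := htl _ h1
      have h3 := hlq _ h1
      rw [smul_inv_smul, mul_smul, mul_smul] at h2
      have h4 := congrArg (fun y => k • y) h2
      simp only [smul_inv_smul] at h4
      rw [← h4] at h3
      exact hx h3
    rw [mul_smul, mul_smul, hs _ h1, smul_inv_smul]
  have hmem : ∀ s ∈ ⁅gp f, gp f⁆, t * s * t⁻¹ ∈ ⁅gp f, gp f⁆ :=
    fun s hs => mul_mem (mul_mem ht hs) (inv_mem ht)
  have hD : ∀ x ∈ {x | c (k • x) = q}, g • x ∉ {x | c (k • x) = q} := by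
    intro x hx hx'
    refine hq _ hx ?_
    rwa [mul_smul, mul_smul, inv_smul_smul]
  have h2 : ⁅t * a * t⁻¹, t * b * t⁻¹⁆ ∈ N :=
    commutator_mem_of_displaced hgN hD (hN _ (hmem a ha)) (hN _ (hmem b hb))
      (hsupp _ fun x hx => (hr x hx).1) (hsupp _ fun x hx => (hr x hx).2)
  have h3 := hN _ (inv_mem ht) _ h2
  have h4 : t⁻¹ * ⁅t * a * t⁻¹, t * b * t⁻¹⁆ * t⁻¹⁻¹ = ⁅a, b⁆ := by
    simp only [commutatorElement_def]; group
  rwa [h4] at h3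

theorem isSimpleGroup_derived (h : RingCoding f c) (hd : Displaces f c) :
    IsSimpleGroup ↥⁅gp f, gp f⁆ where
  exists_pair_ne := ⟨⟨_, Subgroup.commutator_mem_commutator (mem_gp (f := f) 0) (mem_gp (0 + 1))⟩,
    1, fun h1 => h.commutator_ne_one 0 (congrArg Subtype.val h1)⟩
  eq_bot_or_eq_top_of_normal N hN := by
    rw [or_iff_not_imp_left]
    intro hbot
    obtain ⟨⟨g, hg⟩, hgN, hg1⟩ := N.ne_bot_iff_exists_ne_one.1 hbot |>.elim
      fun x hx => (⟨x.1, x.2, fun h1 => hx (Subtype.ext h1)⟩ : ∃ x ∈ N, x ≠ 1)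
    have key := h.derived_le_of_normalized_by_derived hd
      (N := N.map (Subgroup.subtype _)) ?_ (Subgroup.commutator_le_self _ hg)
      ⟨⟨g, hg⟩, hgN, rfl⟩ (fun h1 => hg1 (Subtype.ext h1))
    · rw [eq_top_iff]
      rintro ⟨y, hy⟩ -
      obtain ⟨⟨z, hz⟩, hzN, rfl⟩ := key hy
      exact hzN
    · rintro y hy _ ⟨n, hn, rfl⟩
      exact ⟨_, hN.conj_mem n hn ⟨y, hy⟩, rfl⟩

end RingCoding

/-! ### Itineraries of the expanding map -/

section Itinerary

variable {Γ X : Type*} [Group Γ] [MulAction Γ X]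

/-- The expanding map of a coded ring: `f i` on the cell `(i, false)` and `(f i)⁻¹` on the cell
`(i + 1, true)`. -/
def expand (f : ZMod 4 → Γ) (c : X → ZMod 4 × Bool) (x : X) : X :=
  if (c x).2 then (f ((c x).1 - 1))⁻¹ • x else f (c x).1 • x

/-- The transitions between cells that the expanding map allows. -/
def Admissible (p q : ZMod 4 × Bool) : Prop :=
  if p.2 then q = (p.1 - 1, true) ∨ q = (p.1, false) ∨ q = (p.1, true)
  else q = (p.1, false) ∨ q = (p.1, true) ∨ q = (p.1 + 1, false)

/-- The action of a letter: `(i, true)` acts as `f i` and `(i, false)` as its inverse. -/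
def letter (f : ZMod 4 → Γ) (a : ZMod 4 × Bool) : Γ := cond a.2 (f a.1) (f a.1)⁻¹

variable {f : ZMod 4 → Γ} {c : X → ZMod 4 × Bool}

theorem expand_of_low {i : ZMod 4} {x : X} (hx : c x = (i, false)) :
    expand f c x = f i • x := by simp [expand, hx]

theorem expand_of_high {i : ZMod 4} {x : X} (hx : c x = (i + 1, true)) :
    expand f c x = (f i)⁻¹ • x := by simp [expand, hx]

theorem expand_injOn {x y : X} (hxy : c x = c y) (h : expand f c x = expand f c y) : x = y := by
  unfold expand at h
  rw [hxy] at h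
  split_ifs at h <;> exact smul_left_cancel _ h

namespace RingCoding

theorem admissible (h : RingCoding f c) (x : X) : Admissible (c x) (c (expand f c x)) := by
  rcases hx : c x with ⟨i, b⟩
  cases b
  · rw [expand_of_low hx]
    simpa [Admissible] using h.smul_low i x hx
  · rw [← sub_add_cancel i 1] at hx
    rw [expand_of_high hx]
    have := h.inv_smul_high (i - 1) x hx
    rw [sub_add_cancel] at this
    simpa [Admissible] using this

/-- The expanding map takes each cell onto every cell that an admissible transition reaches. -/
theorem exists_expand_eq (h : RingCoding f c) {q : ZMod 4 × Bool} {x : X}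
    (hq : Admissible q (c x)) : ∃ y, c y = q ∧ expand f c y = x := by
  obtain ⟨i, b⟩ := q
  cases b
  · have h1 := h.inv_smul_low i x (by simpa [Admissible] using hq)
    exact ⟨(f i)⁻¹ • x, h1, by rw [expand_of_low h1, smul_inv_smul]⟩
  · have h1 := h.smul_high (i - 1) x (by simpa [Admissible] using hq)
    refine ⟨f (i - 1) • x, by rwa [sub_add_cancel] at h1, ?_⟩
    rw [expand_of_high h1, inv_smul_smul]

/-- There are points that stay in a given cell for exactly `n + 1` steps. -/
theorem exists_stay (h : RingCoding f c) (q : ZMod 4 × Bool) (n : ℕ) :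
    ∃ x, (∀ j ≤ n, c ((expand f c)^[j] x) = q) ∧ c ((expand f c)^[n + 1] x) ≠ q := by
  induction n with
  | zero =>
    obtain ⟨x, hx⟩ := h.surjective (q.1, !q.2)
    obtain ⟨y, hy, hyx⟩ := h.exists_expand_eq (q := q) (x := x) (by
      rw [hx]; rcases q with ⟨i, b⟩; cases b <;> simp [Admissible])
    refine ⟨y, fun j hj => ?_, ?_⟩
    · obtain rfl : j = 0 := by omega
      exact hy
    · simp only [zero_add, Function.iterate_one, hyx, hx]
      intro h1
      have := congrArg Prod.snd h1
      simp at this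
  | succ n ih =>
    obtain ⟨x, hx, hx'⟩ := ih
    obtain ⟨y, hy, hyx⟩ := h.exists_expand_eq (q := q) (x := x) (by
      rw [show c x = q from hx 0 (Nat.zero_le _)]
      rcases q with ⟨i, b⟩; cases b <;> simp [Admissible])
    refine ⟨y, fun j hj => ?_, ?_⟩
    · cases j with
      | zero => exact hy
      | succ j => rw [Function.iterate_succ_apply, hyx]; exact hx j (by omega)
    · rwa [Function.iterate_succ_apply, hyx]

end RingCoding

variable {Γ' X' : Type*} [Group Γ'] [MulAction Γ' X'] {f' : ZMod 4 → Γ'}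
  {c' : X' → ZMod 4 × Bool}

/-- The first `N` cells visited by `x` and by `y` agree. -/
def Agree (f : ZMod 4 → Γ) (c : X → ZMod 4 × Bool) (f' : ZMod 4 → Γ') (c' : X' → ZMod 4 × Bool)
    (N : ℕ) (x : X) (y : X') : Prop :=
  ∀ k < N, c ((expand f c)^[k] x) = c' ((expand f' c')^[k] y)

theorem Agree.mono {M N : ℕ} {x : X} {y : X'} (h : Agree f c f' c' N x y) (hM : M ≤ N) :
    Agree f c f' c' M x y := fun k hk => h k (hk.trans_le hM)

theorem Agree.expand {N : ℕ} {x : X} {y : X'} (h : Agree f c f' c' (N + 1) x y) :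
    Agree f c f' c' N (expand f c x) (CircleGroups.expand f' c' y) := fun k hk => by
  have := h (k + 1) (by omega)
  simpa only [Function.iterate_succ_apply] using this

theorem Agree.of_expand {N : ℕ} {x : X} {y : X'} (h0 : c x = c' y)
    (h : Agree f c f' c' N (CircleGroups.expand f c x) (CircleGroups.expand f' c' y)) :
    Agree f c f' c' (N + 1) x y := fun k hk => by
  cases k with
  | zero => exact h0
  | succ k =>
    simp only [Function.iterate_succ_apply]
    exact h k (by omega)

theorem eq_of_iterate_expand_eq {k : ℕ} {x y : X}
    (hc : ∀ j < k, c ((expand f c)^[j] x) = c ((expand f c)^[j] y))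
    (h : (expand f c)^[k] x = (expand f c)^[k] y) : x = y := by
  induction k with
  | zero => exact h
  | succ k ih =>
    rw [Function.iterate_succ_apply', Function.iterate_succ_apply'] at h
    exact ih (fun j hj => hc j (by omega)) (expand_injOn (hc k (by omega)) h)

namespace RingCoding

/-- Whether a letter fixes a point, acts as the expanding map or as an inverse branch of it
depends only on the cell of the point. -/
theorem letter_cases (h : RingCoding f c) (h' : RingCoding f' c') (a : ZMod 4 × Bool)
    {x : X} {y : X'} (hxy : c x = c' y) :
    (letter f a • x = x ∧ letter f' a • y = y) ∨
    (letter f a • x = expand f c x ∧ letter f' a • y = expand f' c' y) ∨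
    (expand f c (letter f a • x) = x ∧ expand f' c' (letter f' a • y) = y ∧
      c (letter f a • x) = c' (letter f' a • y)) := by
  obtain ⟨i, b⟩ := a
  cases b
  · simp only [letter, cond_false]
    have low : (c x = (i, false) ∨ c x = (i, true) ∨ c x = (i + 1, false)) →
        (expand f c ((f i)⁻¹ • x) = x ∧ expand f' c' ((f' i)⁻¹ • y) = y ∧
          c ((f i)⁻¹ • x) = c' ((f' i)⁻¹ • y)) := by
      intro hx
      have h1 := h.inv_smul_low i x hx
      have h2 := h'.inv_smul_low i y (hxy ▸ hx)
      rw [expand_of_low h1, expand_of_low h2, smul_inv_smul, smul_inv_smul]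
      exact ⟨rfl, rfl, h1.trans h2.symm⟩
    rcases cell_cases i (c x) with h1 | (h1 | h1 | h1) | h1
    · exact Or.inr (Or.inr (low (Or.inl h1)))
    · exact Or.inr (Or.inr (low (Or.inr (Or.inl h1))))
    · exact Or.inr (Or.inr (low (Or.inr (Or.inr h1))))
    · right; left
      rw [expand_of_high h1, expand_of_high (hxy ▸ h1)]
      exact ⟨rfl, rfl⟩
    · exact Or.inl ⟨h.inv_smul_off i x h1.1 h1.2, h'.inv_smul_off i y (hxy ▸ h1.1) (hxy ▸ h1.2)⟩
  · simp only [letter, cond_true]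
    rcases cell_cases i (c x) with h1 | h1 | h1
    · right; left
      rw [expand_of_low h1, expand_of_low (hxy ▸ h1)]
      exact ⟨rfl, rfl⟩
    · right; right
      have h2 := h.smul_high i x h1
      have h3 := h'.smul_high i y (hxy ▸ h1)
      rw [expand_of_high h2, expand_of_high h3, inv_smul_smul, inv_smul_smul]
      exact ⟨rfl, rfl, h2.trans h3.symm⟩
    · exact Or.inl ⟨h.smul_off i x h1.1 h1.2, h'.smul_off i y (hxy ▸ h1.1) (hxy ▸ h1.2)⟩

/-- A word `w` acts on points with a common itinerary by the same combination of the expanding map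
and its inverse branches: `E^k (w x) = E^m x`, with `k` and `m` independent of the point. -/
theorem exists_iterate_word_eq (h : RingCoding f c) (h' : RingCoding f' c')
    (L : List (ZMod 4 × Bool)) (N : ℕ) {x : X} {y : X'}
    (hxy : Agree f c f' c' (N + L.length) x y) :
    ∃ k ≤ L.length, ∃ m ≤ L.length,
      (expand f c)^[k] ((L.map (letter f)).prod • x) = (expand f c)^[m] x ∧
      (expand f' c')^[k] ((L.map (letter f')).prod • y) = (expand f' c')^[m] y ∧
      Agree f c f' c' N ((L.map (letter f)).prod • x) ((L.map (letter f')).prod • y) := by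
  induction L generalizing N with
  | nil => exact ⟨0, le_rfl, 0, le_rfl, by simp, by simp, by simpa using hxy⟩
  | cons a L ih =>
    obtain ⟨k, hk, m, hm, h1, h2, h3⟩ := ih (N + 1) (by
      rw [List.length_cons] at hxy
      convert hxy using 1
      omega)
    simp only [List.map_cons, List.prod_cons, List.length_cons, mul_smul]
    generalize (L.map (letter f)).prod • x = x1 at h1 h3 ⊢
    generalize (L.map (letter f')).prod • y = y1 at h2 h3 ⊢
    rcases h.letter_cases h' a (h3 0 (by omega)) with ⟨e1, e2⟩ | ⟨e1, e2⟩ | ⟨e1, e2, e3⟩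
    · simp only [Function.iterate_zero, id] at e1 e2
      rw [e1, e2]
      exact ⟨k, by omega, m, by omega, h1, h2, h3.mono (by omega)⟩
    · simp only [Function.iterate_zero, id] at e1 e2
      rw [e1, e2]
      cases k with
      | zero =>
        refine ⟨0, by omega, m + 1, by omega, ?_, ?_, h3.expand⟩
        · rw [Function.iterate_succ_apply', ← h1]; rfl
        · rw [Function.iterate_succ_apply', ← h2]; rfl
      | succ k =>
        rw [Function.iterate_succ_apply] at h1 h2
        exact ⟨k, by omega, m, by omega, h1, h2, h3.expand⟩
    · simp only [Function.iterate_zero, id] at e1 e2 e3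
      refine ⟨k + 1, by omega, m, by omega, ?_, ?_, ?_⟩
      · rw [Function.iterate_succ_apply, e1, h1]
      · rw [Function.iterate_succ_apply, e2, h2]
      · refine (Agree.of_expand e3 ?_).mono (Nat.le_succ N)
        rw [e1, e2]
        exact h3.mono (Nat.le_succ N)

/-- Every finite itinerary of one coding occurs in any other coding, followed by a long constant
stretch that ends. -/
theorem exists_agree_stay (h : RingCoding f c) (h' : RingCoding f' c') (N n : ℕ) (x : X) :
    ∃ y, Agree f c f' c' N x y ∧ ∃ q, (∀ j ≤ n, c' ((expand f' c')^[N + j] y) = q) ∧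
      c' ((expand f' c')^[N + n + 1] y) ≠ q := by
  suffices H : ∃ y, Agree f c f' c' (N + 1) x y ∧ ∃ q,
      (∀ j ≤ n, c' ((expand f' c')^[N + j] y) = q) ∧ c' ((expand f' c')^[N + n + 1] y) ≠ q by
    obtain ⟨y, h1, h2⟩ := H
    exact ⟨y, h1.mono (Nat.le_succ N), h2⟩
  induction N generalizing x with
  | zero =>
    obtain ⟨y, hy, hy'⟩ := h'.exists_stay (c x) n
    refine ⟨y, fun k hk => ?_, c x, by simpa using hy, by simpa using hy'⟩
    obtain rfl : k = 0 := by omega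
    exact (hy 0 (Nat.zero_le _)).symm
  | succ N ih =>
    obtain ⟨y, hy, q, hq, hq'⟩ := ih (expand f c x)
    obtain ⟨z, hz, rfl⟩ := h'.exists_expand_eq (q := c x) (x := y) (by
      have := hy 0 (by omega)
      simp only [Function.iterate_zero, id] at this
      rw [← this]
      exact h.admissible x)
    refine ⟨z, Agree.of_expand hz.symm hy, q, fun j hj => ?_, ?_⟩
    · have := hq j hj
      rwa [← Function.iterate_succ_apply, Nat.succ_eq_add_one, Nat.add_right_comm] at this
    · rwa [← Function.iterate_succ_apply, Nat.succ_eq_add_one,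
        show N + n + 1 + 1 = N + 1 + n + 1 by omega] at hq'

/-- Every finite itinerary of one coding is realized in any other coding by a point whose orbit
does not start repeating early. -/
theorem exists_agree_aperiodic (h : RingCoding f c) (h' : RingCoding f' c') (N : ℕ) (x : X) :
    ∃ y, Agree f c f' c' N x y ∧
      ∀ k m, k ≤ N → m ≤ N → (expand f' c')^[k] y = (expand f' c')^[m] y → k = m := by
  obtain ⟨y, hy, q, hq, hq'⟩ := h.exists_agree_stay h' N N x
  have key : ∀ k m, k < m → m ≤ N → (expand f' c')^[k] y ≠ (expand f' c')^[m] y := by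
    intro k m hkm hm he
    have h1 : (expand f' c')^[N + N + 1] y = (expand f' c')^[N + (N + 1 - (m - k))] y := by
      have e1 : N + N + 1 = (N + N + 1 - m) + m := by omega
      have e2 : N + (N + 1 - (m - k)) = (N + N + 1 - m) + k := by omega
      rw [e1, e2, Function.iterate_add_apply, Function.iterate_add_apply _ _ k, he]
    rw [h1] at hq'
    exact hq' (hq _ (by omega))
  refine ⟨y, hy, fun k m hk hm he => ?_⟩
  rcases lt_trichotomy k m with hlt | heq | hgt
  · exact absurd he (key k m hlt hm)
  · exact heq
  · exact absurd he.symm (key m k hgt hk)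

/-! ### Rigidity -/

variable [FaithfulSMul Γ X]

/-- A relation between the generators that holds in one coded ring holds in every other one. -/
theorem lift_eq_one (h : RingCoding f c) (h' : RingCoding f' c') (w : FreeGroup (ZMod 4))
    (hw : FreeGroup.lift f' w = 1) : FreeGroup.lift f w = 1 := by
  obtain ⟨L, rfl⟩ := Quot.exists_rep w
  have hf : FreeGroup.lift f (FreeGroup.mk L) = (L.map (letter f)).prod := FreeGroup.lift_mk
  have hf' : FreeGroup.lift f' (FreeGroup.mk L) = (L.map (letter f')).prod := FreeGroup.lift_mk
  change FreeGroup.lift f' (FreeGroup.mk L) = 1 at hw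
  change FreeGroup.lift f (FreeGroup.mk L) = 1
  rw [hf'] at hw
  rw [hf]
  refine FaithfulSMul.eq_of_smul_eq_smul fun x : X => ?_
  rw [one_smul]
  obtain ⟨y, hy, hper⟩ := h.exists_agree_aperiodic h' (L.length + L.length) x
  obtain ⟨k, hk, m, hm, h1, h2, h3⟩ := h.exists_iterate_word_eq h' L L.length hy
  rw [hw, one_smul] at h2 h3
  obtain rfl := hper k m (by omega) (by omega) h2
  exact eq_of_iterate_expand_eq
    (fun j hj => (h3 j (by omega)).trans (hy j (by omega)).symm) h1

variable [FaithfulSMul Γ' X']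

/-- Any two coded rings generate isomorphic groups. -/
theorem exists_injective_hom (h : RingCoding f c) (h' : RingCoding f' c') :
    ∃ θ : gp f →* Γ', Function.Injective θ ∧ ∀ g, θ g ∈ gp f' := by
  have hr : ∀ w, FreeGroup.lift f w ∈ gp f := fun w => by
    rw [gp, ← FreeGroup.range_lift_eq_closure]
    exact ⟨w, rfl⟩
  let φ : FreeGroup (ZMod 4) →* gp f := (FreeGroup.lift f).codRestrict _ hr
  have hφ : Function.Surjective φ := by
    rintro ⟨g, hg⟩
    have := hg
    rw [gp, ← FreeGroup.range_lift_eq_closure] at this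
    obtain ⟨w, rfl⟩ := this
    exact ⟨w, rfl⟩
  have hker : φ.ker ≤ (FreeGroup.lift f').ker := fun w hw =>
    h'.lift_eq_one h w (congrArg Subtype.val hw)
  let θ := φ.liftOfSurjective hφ ⟨FreeGroup.lift f', hker⟩
  have hθ : ∀ w, θ (φ w) = FreeGroup.lift f' w := fun w =>
    φ.liftOfRightInverse_comp_apply _ (Function.rightInverse_surjInv hφ) _ w
  refine ⟨θ, (injective_iff_map_eq_one θ).2 fun g hg => ?_, fun g => ?_⟩
  · obtain ⟨w, rfl⟩ := hφ g
    rw [hθ] at hg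
    exact Subtype.ext (h.lift_eq_one h' w hg)
  · obtain ⟨w, rfl⟩ := hφ g
    rw [hθ, gp, ← FreeGroup.range_lift_eq_closure]
    exact ⟨w, rfl⟩

end RingCoding

end Itinerary


/-! ### Homeomorphisms of the circle and their lifts -/

/-- Homeomorphisms of the circle act by evaluation. -/
instance : MulAction HomeoS1 S1 where
  smul φ x := φ x
  one_smul _ := rfl
  mul_smul _ _ _ := rfl

theorem homeo_smul_def (φ : HomeoS1) (x : S1) : φ • x = φ x := rfl

instance : FaithfulSMul HomeoS1 S1 where
  eq_of_smul_eq_smul h := Homeomorph.ext h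

theorem coe_eq_coe_iff {x y : ℝ} : (x : S1) = (y : S1) ↔ ∃ n : ℤ, y = x + n := by
  rw [eq_comm, ← sub_eq_zero, ← AddCircle.coe_sub, AddCircle.coe_eq_zero_iff]
  simp only [zsmul_eq_mul, mul_one]
  exact exists_congr fun n => by constructor <;> intro h <;> linarith

theorem map_add_intCast {F : ℝ → ℝ} (hF : ∀ x, F (x + 1) = F x + 1) (x : ℝ) (n : ℤ) :
    F (x + n) = F x + n := by
  have h : ∀ (n : ℕ) (x : ℝ), F (x + n) = F x + n := by
    intro n
    induction n with
    | zero => simp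
    | succ n ih => intro x; push_cast; rw [← add_assoc, hF, ih, add_assoc]
  obtain ⟨m, rfl | rfl⟩ := n.eq_nat_or_neg
  · exact_mod_cast h m x
  · have := h m (x + ((-(m : ℤ) : ℤ) : ℝ))
    push_cast at this ⊢
    rw [neg_add_cancel_right] at this
    linarith

theorem symm_add_one {F : ℝ ≃o ℝ} (hF : ∀ x, F (x + 1) = F x + 1) (x : ℝ) :
    F.symm (x + 1) = F.symm x + 1 := by
  rw [OrderIso.symm_apply_eq, hF, OrderIso.apply_symm_apply]

theorem periodic_coe {F : ℝ ≃o ℝ} (hF : ∀ x, F (x + 1) = F x + 1) :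
    Function.Periodic (fun x => (F x : S1)) 1 := fun x => by
  simp only [hF, AddCircle.coe_add_period]

/-- The homeomorphism of the circle with a given lift. -/
def circleHomeo (F : ℝ ≃o ℝ) (hF : ∀ x, F (x + 1) = F x + 1) : HomeoS1 where
  toFun := (periodic_coe hF).lift
  invFun := (periodic_coe (symm_add_one hF)).lift
  left_inv x := by
    induction x using QuotientAddGroup.induction_on with
    | H x => exact congrArg _ (F.symm_apply_apply x)
  right_inv x := by
    induction x using QuotientAddGroup.induction_on with
    | H x => exact congrArg _ (F.apply_symm_apply x)
  continuous_toFun := continuous_coinduced_dom.2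
    ((AddCircle.continuous_mk' 1).comp F.continuous)
  continuous_invFun := continuous_coinduced_dom.2
    ((AddCircle.continuous_mk' 1).comp F.symm.continuous)

/-! ### Rings made of four rotated copies of one homeomorphism -/

/-- A lift to the line of a homeomorphism of the circle supported in the image of `(0, 1/2)`,
with a point `τ < 1/4` that it moves by exactly a quarter turn. -/
structure RingTemplate where
  F : ℝ ≃o ℝ
  τ : ℝ
  map_add_one : ∀ x, F (x + 1) = F x + 1
  map_eq_self : ∀ x ∈ Icc (1 / 2 : ℝ) 1, F x = x
  lt_map : ∀ x ∈ Ioo (0 : ℝ) (1 / 2), x < F x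
  τ_pos : 0 < τ
  τ_lt : τ < 1 / 4
  map_τ : F τ = τ + 1 / 4

namespace RingTemplate

variable (T : RingTemplate)

/-- The lift of the `i`-th homeomorphism of the ring: the conjugate of `F` by the translation by
`i / 4`. -/
noncomputable def gen (i : ZMod 4) : ℝ ≃o ℝ :=
  (OrderIso.addRight (-(i.val / 4 : ℝ))).trans (T.F.trans (OrderIso.addRight (i.val / 4 : ℝ)))

theorem gen_intCast (k : ℤ) (x : ℝ) : T.gen (k : ZMod 4) x = T.F (x - k / 4) + k / 4 := by
  have h1 : T.gen (k : ZMod 4) x =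
      T.F (x + -(((k : ZMod 4).val : ℝ) / 4)) + ((k : ZMod 4).val : ℝ) / 4 := rfl
  have h2 : (((k : ZMod 4).val : ℤ) : ℝ) = ((k % 4 : ℤ) : ℝ) := by
    rw [ZMod.val_intCast]; rfl
  have h3 : ((k : ℤ) : ℝ) = ((k % 4 : ℤ) : ℝ) + 4 * ((k / 4 : ℤ) : ℝ) := by
    exact_mod_cast (Int.emod_add_mul_ediv k 4).symm
  rw [h1]
  simp only [Int.cast_natCast] at h2
  rw [h2]
  have h4 : x + -(((k % 4 : ℤ) : ℝ) / 4) = (x - k / 4) + ((k / 4 : ℤ) : ℝ) := by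
    rw [h3]; ring
  rw [h4, map_add_intCast T.map_add_one, h3]
  ring

theorem gen_add_one (i : ZMod 4) (x : ℝ) : T.gen i (x + 1) = T.gen i x + 1 := by
  obtain ⟨k, rfl⟩ := ZMod.intCast_surjective i
  rw [gen_intCast, gen_intCast, add_sub_right_comm, T.map_add_one]
  ring

theorem map_half : T.F (1 / 2) = 1 / 2 := T.map_eq_self _ ⟨le_rfl, by norm_num⟩

theorem map_zero : T.F 0 = 0 := by
  have h1 := T.map_add_one 0
  rw [zero_add, T.map_eq_self 1 ⟨by norm_num, le_rfl⟩] at h1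
  linarith

theorem map_mem_low_iff {x : ℝ} : T.F x ∈ Ico 0 (T.τ + 1 / 4) ↔ x ∈ Ico 0 T.τ := by
  rw [mem_Ico, mem_Ico, ← T.map_τ, T.F.lt_iff_lt]
  nth_rewrite 1 [← T.map_zero]
  rw [T.F.le_iff_le]

theorem map_mem_high_iff {x : ℝ} :
    T.F x ∈ Ico (T.τ + 1 / 4) (1 / 2) ↔ x ∈ Ico T.τ (1 / 2) := by
  rw [mem_Ico, mem_Ico, ← T.map_τ, T.F.le_iff_le]
  nth_rewrite 1 [← T.map_half]
  rw [T.F.lt_iff_lt]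

/-- The cell of a real number: `(k, false)` on `[k/4, k/4 + τ)` and `(k, true)` on
`[k/4 + τ, (k+1)/4)`. -/
noncomputable def lineCell (x : ℝ) : ℤ × Bool :=
  (⌊4 * x⌋, decide (T.τ ≤ x - ⌊4 * x⌋ / 4))

theorem lineCell_eq_false_iff {x : ℝ} {k : ℤ} :
    T.lineCell x = (k, false) ↔ (k / 4 : ℝ) ≤ x ∧ x < k / 4 + T.τ := by
  have h2 := T.τ_lt
  simp only [lineCell, Prod.mk.injEq, decide_eq_false_iff_not, not_le]
  constructor
  · rintro ⟨rfl, h⟩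
    have := Int.floor_le (4 * x)
    constructor <;> linarith
  · rintro ⟨h1, h3⟩
    have : ⌊4 * x⌋ = k := Int.floor_eq_iff.2 ⟨by linarith, by linarith⟩
    rw [this]
    exact ⟨rfl, by linarith⟩

theorem lineCell_eq_true_iff {x : ℝ} {k : ℤ} :
    T.lineCell x = (k, true) ↔ (k / 4 : ℝ) + T.τ ≤ x ∧ x < k / 4 + 1 / 4 := by
  have h2 := T.τ_pos
  simp only [lineCell, Prod.mk.injEq, decide_eq_true_eq]
  constructor
  · rintro ⟨rfl, h⟩
    have := Int.lt_floor_add_one (4 * x)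
    constructor <;> linarith
  · rintro ⟨h1, h3⟩
    have : ⌊4 * x⌋ = k := Int.floor_eq_iff.2 ⟨by linarith, by linarith⟩
    rw [this]
    exact ⟨rfl, by linarith⟩

/-- The cell of a real number, with its index modulo `4`. -/
noncomputable def cell (x : ℝ) : ZMod 4 × Bool := ((T.lineCell x).1, (T.lineCell x).2)

theorem cell_periodic : Function.Periodic T.cell 1 := by
  intro x
  have h1 : ⌊4 * (x + 1)⌋ = ⌊4 * x⌋ + 4 := by
    rw [mul_add, mul_one]; exact_mod_cast Int.floor_add_ofNat (4 * x) 4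
  have h4 : (4 : ZMod 4) = 0 := by decide
  have h2 : x + 1 - ((⌊4 * x⌋ : ℝ) + 4) / 4 = x - ⌊4 * x⌋ / 4 := by ring
  simp [cell, lineCell, h1, h2, h4]

theorem cell_eq_of_lineCell {x : ℝ} {k : ℤ} {b : Bool} (h : T.lineCell x = (k, b)) :
    T.cell x = ((k : ZMod 4), b) := by
  simp [cell, h]

theorem exists_lineCell_of_cell {x : ℝ} {i : ZMod 4} {b : Bool} (h : T.cell x = (i, b)) :
    ∃ k : ℤ, (k : ZMod 4) = i ∧ T.lineCell x = (k, b) :=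
  have h2 : (T.cell x).2 = b := congrArg Prod.snd h
  ⟨(T.lineCell x).1, congrArg Prod.fst h, Prod.ext rfl h2⟩

theorem lineCoding : RingCoding T.gen T.cell where
  surjective := by
    rintro ⟨i, b⟩
    obtain ⟨k, rfl⟩ := ZMod.intCast_surjective i
    have h1 := T.τ_pos
    have h2 := T.τ_lt
    cases b
    · exact ⟨k / 4, T.cell_eq_of_lineCell (T.lineCell_eq_false_iff.2 ⟨le_rfl, by linarith⟩)⟩
    · exact ⟨k / 4 + T.τ, T.cell_eq_of_lineCell
        (T.lineCell_eq_true_iff.2 ⟨le_rfl, by linarith⟩)⟩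
  smul_low := by
    intro i x hx
    obtain ⟨k, rfl, hk⟩ := T.exists_lineCell_of_cell hx
    rw [T.lineCell_eq_false_iff] at hk
    have h1 : T.F (x - k / 4) ∈ Ico 0 (T.τ + 1 / 4) :=
      T.map_mem_low_iff.2 ⟨by linarith, by linarith⟩
    have h2 : T.gen (k : ZMod 4) • x = T.F (x - k / 4) + k / 4 := T.gen_intCast k x
    rw [h2]
    generalize T.F (x - k / 4) = y at h1
    rcases lt_or_ge y T.τ with h3 | h3
    · left
      exact T.cell_eq_of_lineCell (T.lineCell_eq_false_iff.2 ⟨by linarith [h1.1], by linarith⟩)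
    rcases lt_or_ge y (1 / 4) with h4 | h4
    · right; left
      exact T.cell_eq_of_lineCell (T.lineCell_eq_true_iff.2 ⟨by linarith, by linarith⟩)
    · right; right
      have := T.cell_eq_of_lineCell (x := y + k / 4) (k := k + 1) (b := false)
        (T.lineCell_eq_false_iff.2 ⟨by push_cast; linarith, by push_cast; linarith [h1.2]⟩)
      simpa using this
  smul_high := by
    intro i x hx
    have h1 := T.τ_pos
    have h2 := T.τ_lt
    obtain ⟨k, rfl, hk1, hk2⟩ : ∃ k : ℤ, (k : ZMod 4) = i ∧ (k / 4 : ℝ) + T.τ ≤ x ∧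
        x < k / 4 + 1 / 2 := by
      rcases hx with hx | hx | hx
      · obtain ⟨k, rfl, hk⟩ := T.exists_lineCell_of_cell hx
        rw [T.lineCell_eq_true_iff] at hk
        exact ⟨k, rfl, by linarith, by linarith⟩
      · obtain ⟨k, hki, hk⟩ := T.exists_lineCell_of_cell hx
        rw [T.lineCell_eq_false_iff] at hk
        refine ⟨k - 1, by push_cast; rw [hki, add_sub_cancel_right], ?_, ?_⟩ <;> push_cast <;>
          linarith
      · obtain ⟨k, hki, hk⟩ := T.exists_lineCell_of_cell hx
        rw [T.lineCell_eq_true_iff] at hk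
        refine ⟨k - 1, by push_cast; rw [hki, add_sub_cancel_right], ?_, ?_⟩ <;> push_cast <;>
          linarith
    have h3 : T.F (x - k / 4) ∈ Ico (T.τ + 1 / 4) (1 / 2) :=
      T.map_mem_high_iff.2 ⟨by linarith, by linarith⟩
    have h4 : T.gen (k : ZMod 4) • x = T.F (x - k / 4) + k / 4 := T.gen_intCast k x
    rw [h4]
    have := T.cell_eq_of_lineCell (x := T.F (x - k / 4) + k / 4) (k := k + 1) (b := true)
      (T.lineCell_eq_true_iff.2
        ⟨by push_cast; linarith [h3.1], by push_cast; linarith [h3.2]⟩)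
    simpa using this
  smul_off := by
    intro i x h1 h2
    have four : ∀ i j : ZMod 4, j ≠ i → j ≠ i + 1 → i = j - 2 ∨ i = j - 3 := by decide
    obtain ⟨k, rfl, hk1, hk2⟩ : ∃ k : ℤ, (k : ZMod 4) = i ∧ (k / 4 : ℝ) + 1 / 2 ≤ x ∧
        x < k / 4 + 1 := by
      have h3 := Int.floor_le (4 * x)
      have h4 := Int.lt_floor_add_one (4 * x)
      rcases four i (T.cell x).1 h1 h2 with h5 | h5
      · refine ⟨⌊4 * x⌋ - 2, by rw [h5]; push_cast; rfl, ?_, ?_⟩ <;> push_cast <;> linarith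
      · refine ⟨⌊4 * x⌋ - 3, by rw [h5]; push_cast; rfl, ?_, ?_⟩ <;> push_cast <;> linarith
    have h4 : T.gen (k : ZMod 4) • x = T.F (x - k / 4) + k / 4 := T.gen_intCast k x
    rw [h4, T.map_eq_self _ ⟨by linarith, by linarith⟩]
    ring

/-- The homeomorphisms of the circle that form the ring. -/
noncomputable def circleGen (i : ZMod 4) : HomeoS1 := circleHomeo (T.gen i) (T.gen_add_one i)

/-- The cell of a point of the circle. -/
noncomputable def circleCell : S1 → ZMod 4 × Bool := T.cell_periodic.lift

theorem circleGen_coe (i : ZMod 4) (x : ℝ) : T.circleGen i (x : S1) = (T.gen i x : S1) := rfl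

theorem circleCoding : RingCoding T.circleGen T.circleCell where
  surjective p := by
    obtain ⟨x, hx⟩ := T.lineCoding.surjective p
    exact ⟨(x : S1), hx⟩
  smul_low i x hx := by
    induction x using QuotientAddGroup.induction_on with
    | H x => exact T.lineCoding.smul_low i x hx
  smul_high i x hx := by
    induction x using QuotientAddGroup.induction_on with
    | H x => exact T.lineCoding.smul_high i x hx
  smul_off i x h1 h2 := by
    induction x using QuotientAddGroup.induction_on with
    | H x => exact congrArg _ (T.lineCoding.smul_off i x h1 h2)

end RingTemplate

/-! ### The arcs of the ring -/

/-- The open arc from `i / 4` to `i / 4 + 1 / 2`. -/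
def ringArc (i : ZMod 4) : Set S1 :=
  (fun x : ℝ => (x : S1)) '' Ioo (i.val / 4 : ℝ) (i.val / 4 + 1 / 2)

theorem coe_mem_image_iff {x : ℝ} {s : Set ℝ} :
    (x : S1) ∈ (fun x : ℝ => (x : S1)) '' s ↔ ∃ m : ℤ, x + m ∈ s := by
  constructor
  · rintro ⟨y, hy, hxy⟩
    obtain ⟨n, rfl⟩ := coe_eq_coe_iff.1 hxy.symm
    exact ⟨n, hy⟩
  · rintro ⟨m, hm⟩
    exact ⟨x + m, hm, coe_eq_coe_iff.2 ⟨-m, by push_cast; ring⟩⟩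

theorem coe_mem_ringArc_iff {x : ℝ} {k : ℤ} :
    (x : S1) ∈ ringArc (k : ZMod 4) ↔ ∃ m : ℤ, x + m ∈ Ioo (k / 4 : ℝ) (k / 4 + 1 / 2) := by
  have h2 : (((k : ZMod 4).val : ℤ) : ℝ) = ((k % 4 : ℤ) : ℝ) := by
    rw [ZMod.val_intCast]; rfl
  have h3 : ((k : ℤ) : ℝ) = ((k % 4 : ℤ) : ℝ) + 4 * ((k / 4 : ℤ) : ℝ) := by
    exact_mod_cast (Int.emod_add_mul_ediv k 4).symm
  rw [Int.cast_natCast] at h2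
  rw [ringArc, coe_mem_image_iff, h2]
  constructor
  · rintro ⟨m, h4, h5⟩
    refine ⟨m + k / 4, ?_, ?_⟩ <;> rw [h3] <;> push_cast <;> linarith
  · rintro ⟨m, h4, h5⟩
    rw [h3] at h4 h5
    refine ⟨m - k / 4, ?_, ?_⟩ <;> push_cast <;> linarith

theorem ringArc_intCast (k : ℤ) : ringArc (k : ZMod 4) =
    (fun x : ℝ => (x : S1)) '' Ioo (k / 4 : ℝ) (k / 4 + 1 / 2) := by
  ext x
  induction x using QuotientAddGroup.induction_on with
  | H x => exact coe_mem_ringArc_iff.trans coe_mem_image_iff.symm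

theorem isOpen_ringArc (i : ZMod 4) : IsOpen (ringArc i) :=
  QuotientAddGroup.isOpenMap_coe _ isOpen_Ioo

theorem ringArc_inter (k : ℤ) : ringArc (k : ZMod 4) ∩ ringArc ((k : ZMod 4) + 1) =
    (fun x : ℝ => (x : S1)) '' Ioo (k / 4 + 1 / 4 : ℝ) (k / 4 + 1 / 2) := by
  have hk : (k : ZMod 4) + 1 = ((k + 1 : ℤ) : ZMod 4) := by push_cast; rfl
  rw [hk]
  ext x
  induction x using QuotientAddGroup.induction_on with
  | H x =>
    refine Iff.trans (and_congr coe_mem_ringArc_iff coe_mem_ringArc_iff) ?_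
    refine Iff.trans ?_ coe_mem_image_iff.symm
    constructor
    · rintro ⟨⟨m, h1, h2⟩, ⟨l, h3, h4⟩⟩
      push_cast at h3 h4
      have h5 : ((l - m : ℤ) : ℝ) < 1 := by push_cast; linarith
      have h6 : ((-1 : ℤ) : ℝ) < ((l - m : ℤ) : ℝ) := by push_cast; linarith
      have h5' : l - m < 1 := by exact_mod_cast h5
      have h6' : -1 < l - m := by exact_mod_cast h6
      obtain rfl : l = m := by omega
      exact ⟨l, by linarith, by linarith⟩
    · rintro ⟨m, h1, h2⟩
      refine ⟨⟨m, ?_, ?_⟩, ⟨m, ?_, ?_⟩⟩ <;> push_cast <;> linarith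

theorem not_int_mem_Ioo {a b : ℝ} {m : ℤ} (h1 : a < m) (h2 : m < b) (ha : 0 ≤ a)
    (hb : b ≤ 1) : False := by
  have h3 : ((0 : ℤ) : ℝ) < m := by push_cast; linarith
  have h4 : (m : ℝ) < ((1 : ℤ) : ℝ) := by push_cast; linarith
  have h3' : 0 < m := by exact_mod_cast h3
  have h4' : m < 1 := by exact_mod_cast h4
  omega

namespace RingTemplate

variable (T : RingTemplate)

theorem mem_ringArc_of_circleCell {i : ZMod 4} {x : S1} (hx : T.circleCell x = (i, true)) :
    x ∈ ringArc i := by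
  induction x using QuotientAddGroup.induction_on with
  | H x =>
    obtain ⟨k, rfl, hk⟩ := T.exists_lineCell_of_cell hx
    rw [T.lineCell_eq_true_iff] at hk
    have := T.τ_pos
    refine coe_mem_ringArc_iff.2 ⟨0, ?_, ?_⟩ <;> push_cast <;> linarith

theorem ringArc_eq_support (i : ZMod 4) : ringArc i = {x | T.circleGen i x ≠ x} := by
  obtain ⟨k, rfl⟩ := ZMod.intCast_surjective i
  ext x
  induction x using QuotientAddGroup.induction_on with
  | H x =>
    obtain ⟨n, s, hx, hs0, hs1⟩ : ∃ (n : ℤ) (s : ℝ), x = k / 4 + s + n ∧ 0 ≤ s ∧ s < 1 :=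
      ⟨⌊x - k / 4⌋, Int.fract (x - k / 4), by linarith [Int.floor_add_fract (x - k / 4 : ℝ)],
        Int.fract_nonneg _, Int.fract_lt_one _⟩
    have hgen : T.gen (k : ZMod 4) x = x + (T.F s - s) := by
      rw [T.gen_intCast, hx, show (k / 4 + s + n - k / 4 : ℝ) = s + n by ring,
        map_add_intCast T.map_add_one]
      ring
    have hmem : ((x : ℝ) : S1) ∈ ringArc (k : ZMod 4) ↔ s ∈ Ioo (0 : ℝ) (1 / 2) := by
      rw [coe_mem_ringArc_iff]
      constructor
      · rintro ⟨m, h1, h2⟩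
        rw [hx] at h1 h2
        have h3 : ((-1 : ℤ) : ℝ) < ((n + m : ℤ) : ℝ) := by push_cast; linarith
        have h4 : ((n + m : ℤ) : ℝ) < ((1 : ℤ) : ℝ) := by push_cast; linarith
        have h3' : -1 < n + m := by exact_mod_cast h3
        have h4' : n + m < 1 := by exact_mod_cast h4
        have h5 : ((n + m : ℤ) : ℝ) = 0 := by
          rw [show n + m = 0 by omega]; norm_num
        push_cast at h5
        constructor <;> linarith
      · rintro ⟨h1, h2⟩
        refine ⟨-n, ?_, ?_⟩ <;> push_cast <;> linarith
    refine hmem.trans ?_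
    change _ ↔ ((T.gen (k : ZMod 4) x : ℝ) : S1) ≠ (x : S1)
    rw [hgen]
    constructor
    · intro hs heq
      obtain ⟨m, hm⟩ := coe_eq_coe_iff.1 heq.symm
      have h1 := T.lt_map s hs
      have h2 : T.F s < 1 / 2 := by
        have := T.F.lt_iff_lt.2 hs.2
        rwa [T.map_half] at this
      exact not_int_mem_Ioo (a := 0) (b := 1 / 2) (m := m) (by linarith)
        (by linarith [hs.1]) le_rfl (by norm_num)
    · intro hne
      by_contra hs
      apply hne
      have : T.F s = s := by
        rcases hs0.eq_or_lt with h1 | h1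
        · rw [← h1, T.map_zero]
        · exact T.map_eq_self s ⟨not_lt.1 fun h2 => hs ⟨h1, h2⟩, hs1.le⟩
      rw [this, sub_self, add_zero]

/-- The point of a ring entering the fast condition lies in the cell `(i + 1, false)`. -/
theorem circleCell_of_mem_frontier {i : ZMod 4} {x : S1}
    (hx : x ∈ frontier (ringArc (i + 1)) ∩ ringArc i) : T.circleCell x = (i + 1, false) := by
  obtain ⟨k, rfl⟩ := ZMod.intCast_surjective i
  have hk : (k : ZMod 4) + 1 = ((k + 1 : ℤ) : ZMod 4) := by push_cast; rfl
  obtain ⟨hx1, hx2⟩ := hx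
  rw [(isOpen_ringArc _).frontier_eq, hk] at hx1
  have hcl : closure (ringArc ((k + 1 : ℤ) : ZMod 4)) ⊆ (fun x : ℝ => (x : S1)) ''
      Icc (((k + 1 : ℤ) : ℝ) / 4) (((k + 1 : ℤ) : ℝ) / 4 + 1 / 2) := by
    refine closure_minimal ?_ (isCompact_Icc.image (AddCircle.continuous_mk' 1)).isClosed
    rw [ringArc_intCast]
    exact image_mono Ioo_subset_Icc_self
  obtain ⟨t, ht, rfl⟩ := hcl hx1.1
  have ht' : ¬ (t ∈ Ioo (((k + 1 : ℤ) : ℝ) / 4) (((k + 1 : ℤ) : ℝ) / 4 + 1 / 2)) := by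
    intro h1
    apply hx1.2
    rw [ringArc_intCast]
    exact ⟨t, h1, rfl⟩
  rcases ht.1.eq_or_lt with h1 | h1
  · have h2 := T.τ_pos
    have := T.cell_eq_of_lineCell (x := t) (k := k + 1) (b := false)
      (T.lineCell_eq_false_iff.2 ⟨h1.le, by linarith⟩)
    rw [hk]
    exact this
  · exfalso
    have h2 : t = ((k + 1 : ℤ) : ℝ) / 4 + 1 / 2 :=
      le_antisymm ht.2 (not_lt.1 fun h2 => ht' ⟨h1, h2⟩)
    obtain ⟨m, h3, h4⟩ := coe_mem_ringArc_iff.1 hx2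
    rw [h2] at h3 h4
    push_cast at h3 h4
    exact not_int_mem_Ioo (a := 1 / 4) (b := 3 / 4) (m := -m) (by push_cast; linarith)
      (by push_cast; linarith) (by norm_num) (by norm_num)

theorem isFastRing : IsFastRing ringArc T.circleGen where
  isOpen := isOpen_ringArc
  isConnected i :=
    (isConnected_Ioo (by linarith)).image _ (AddCircle.continuous_mk' 1).continuousOn
  cover := by
    refine eq_univ_of_forall fun x => ?_
    induction x using QuotientAddGroup.induction_on with
    | H x =>
      refine mem_iUnion.2 ⟨((⌈4 * x⌉ - 1 : ℤ) : ZMod 4), coe_mem_ringArc_iff.2 ⟨0, ?_, ?_⟩⟩ <;>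
        push_cast <;> linarith [Int.le_ceil (4 * x), Int.ceil_lt_add_one (4 * x)]
  disjoint i j h1 h2 h3 := by
    obtain ⟨k, rfl⟩ := ZMod.intCast_surjective i
    obtain ⟨l, rfl⟩ := ZMod.intCast_surjective j
    rw [disjoint_left]
    intro x
    induction x using QuotientAddGroup.induction_on with
    | H x =>
      intro hx hx'
      obtain ⟨m, h4, h5⟩ := coe_mem_ringArc_iff.1 hx
      obtain ⟨n, h6, h7⟩ := coe_mem_ringArc_iff.1 hx'
      have h8 : ((-2 : ℤ) : ℝ) < ((l - k - 4 * (n - m) : ℤ) : ℝ) := by push_cast; linarith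
      have h9 : ((l - k - 4 * (n - m) : ℤ) : ℝ) < ((2 : ℤ) : ℝ) := by push_cast; linarith
      have h8' : -2 < l - k - 4 * (n - m) := by exact_mod_cast h8
      have h9' : l - k - 4 * (n - m) < 2 := by exact_mod_cast h9
      have h4z : (4 : ZMod 4) = 0 := by decide
      have h10 : ((l - k - 4 * (n - m) : ℤ) : ZMod 4) = l - k := by
        push_cast; rw [h4z]; ring
      generalize l - k - 4 * (n - m) = z at h8' h9' h10
      interval_cases z
      · apply h3
        push_cast at h10
        linear_combination h10
      · apply h1
        push_cast at h10
        linear_combination h10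
      · apply h2
        push_cast at h10
        linear_combination -h10
  overlap_connected i := by
    obtain ⟨k, rfl⟩ := ZMod.intCast_surjective i
    rw [ringArc_inter]
    exact (isConnected_Ioo (by linarith)).image _ (AddCircle.continuous_mk' 1).continuousOn
  overlap_proper_left i h := by
    obtain ⟨k, rfl⟩ := ZMod.intCast_surjective i
    have h1 : ((k / 4 + 1 / 8 : ℝ) : S1) ∈ ringArc (k : ZMod 4) :=
      coe_mem_ringArc_iff.2 ⟨0, by push_cast; linarith, by push_cast; linarith⟩
    rw [← h, ringArc_inter] at h1
    obtain ⟨m, h2, h3⟩ := coe_mem_image_iff.1 h1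
    exact not_int_mem_Ioo (a := 1 / 8) (b := 3 / 8) (m := m) (by linarith) (by linarith)
      (by norm_num) (by norm_num)
  overlap_proper_right i h := by
    obtain ⟨k, rfl⟩ := ZMod.intCast_surjective i
    have hk : (k : ZMod 4) + 1 = ((k + 1 : ℤ) : ZMod 4) := by push_cast; rfl
    have h1 : ((k / 4 + 5 / 8 : ℝ) : S1) ∈ ringArc ((k : ZMod 4) + 1) := by
      rw [hk]
      exact coe_mem_ringArc_iff.2 ⟨0, by push_cast; linarith, by push_cast; linarith⟩
    rw [← h, ringArc_inter] at h1
    obtain ⟨m, h2, h3⟩ := coe_mem_image_iff.1 h1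
    exact not_int_mem_Ioo (a := 1 / 8) (b := 3 / 8) (m := -m) (by push_cast; linarith)
      (by push_cast; linarith) (by norm_num) (by norm_num)
  support := T.ringArc_eq_support
  fast i x hx l _ _ := by
    refine T.mem_ringArc_of_circleCell ?_
    have h0 := T.circleCell_of_mem_frontier hx
    have : ∀ l : ℕ, T.circleCell (ringOrbit T.circleGen i x l) =
        (i + ((l + 1 : ℕ) : ZMod 4), true) := by
      intro l
      induction l with
      | zero =>
        have := T.circleCoding.smul_high i x (Or.inr (Or.inl h0))
        simpa [ringOrbit, homeo_smul_def] using this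
      | succ l ih =>
        have := T.circleCoding.smul_high (i + ((l + 1 : ℕ) : ZMod 4))
          (ringOrbit T.circleGen i x l) (Or.inl ih)
        rw [add_assoc, ← Nat.cast_succ] at this
        exact this
    exact this l

end RingTemplate


/-! ### Expanding templates have no wandering intervals -/

namespace RingTemplate

variable (T : RingTemplate)

/-- The map `F` of the template expands lengths at least twice to the left of `τ`, and contracts
them at least twice between `τ` and `1 / 2`. -/
structure IsExpanding : Prop where
  low : ∀ u v, 0 ≤ u → u ≤ v → v < T.τ → 2 * (v - u) ≤ T.F v - T.F u
  high : ∀ u v, T.τ ≤ u → u ≤ v → v < 1 / 2 → 2 * (T.F v - T.F u) ≤ v - u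

variable {T}

theorem IsExpanding.abs_low (hT : T.IsExpanding) {u v : ℝ} (hu : u ∈ Ico 0 T.τ)
    (hv : v ∈ Ico 0 T.τ) : |v - u| ≤ |T.F v - T.F u| / 2 := by
  rcases le_total u v with h | h
  · have := hT.low u v hu.1 h hv.2
    rw [abs_of_nonneg (by linarith), abs_of_nonneg (by linarith)]
    linarith
  · have := hT.low v u hv.1 h hu.2
    rw [abs_of_nonpos (by linarith), abs_of_nonpos (by linarith)]
    linarith

theorem IsExpanding.abs_high (hT : T.IsExpanding) {u v : ℝ} (hu : u ∈ Ico T.τ (1 / 2))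
    (hv : v ∈ Ico T.τ (1 / 2)) : |T.F v - T.F u| ≤ |v - u| / 2 := by
  rcases le_total u v with h | h
  · have := hT.high u v hu.1 h hv.2
    have h2 := T.F.monotone h
    rw [abs_of_nonneg (by linarith), abs_of_nonneg (by linarith)]
    linarith
  · have := hT.high v u hv.1 h hu.2
    have h2 := T.F.monotone h
    rw [abs_of_nonpos (by linarith), abs_of_nonpos (by linarith)]
    linarith

theorem int_eq_of_lt {m k : ℤ} (h1 : (m : ℝ) < k + 1) (h2 : (k : ℝ) < m + 1) : m = k := by
  have h1' : m < k + 1 := by exact_mod_cast h1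
  have h2' : k < m + 1 := by exact_mod_cast h2
  omega

/-- The interval `[k/4, (k+1)/4 + τ)` is a union of cells. -/
theorem low_of_lineCell_eq {k : ℤ} {y z : ℝ} (h : T.lineCell y = T.lineCell z)
    (hz : z - k / 4 ∈ Ico 0 (T.τ + 1 / 4)) : y - k / 4 ∈ Ico 0 (T.τ + 1 / 4) := by
  have h1 := T.τ_pos
  have h2 := T.τ_lt
  obtain ⟨hz1, hz2⟩ := hz
  rcases hm : T.lineCell z with ⟨m, b⟩
  rw [hm] at h
  cases b
  · rw [lineCell_eq_false_iff] at h hm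
    rcases lt_or_ge (m : ℝ) (k + 1) with h3 | h3
    · obtain rfl := int_eq_of_lt h3 (by linarith)
      constructor <;> linarith
    · have : m = k + 1 := int_eq_of_lt (by push_cast; linarith) (by push_cast; linarith)
      rw [this] at h
      push_cast at h
      constructor <;> linarith
  · rw [lineCell_eq_true_iff] at h hm
    obtain rfl : m = k := int_eq_of_lt (by linarith) (by linarith)
    constructor <;> linarith

/-- The interval `[k/4 + τ, k/4 + 1/2)` is a union of cells. -/
theorem high_of_lineCell_eq {k : ℤ} {y z : ℝ} (h : T.lineCell y = T.lineCell z)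
    (hz : z - k / 4 ∈ Ico T.τ (1 / 2)) : y - k / 4 ∈ Ico T.τ (1 / 2) := by
  have h1 := T.τ_pos
  have h2 := T.τ_lt
  obtain ⟨hz1, hz2⟩ := hz
  rcases hm : T.lineCell z with ⟨m, b⟩
  rw [hm] at h
  cases b
  · rw [lineCell_eq_false_iff] at h hm
    have : m = k + 1 := int_eq_of_lt (by push_cast; linarith) (by push_cast; linarith)
    rw [this] at h
    push_cast at h
    constructor <;> linarith
  · rw [lineCell_eq_true_iff] at h hm
    rcases lt_or_ge (m : ℝ) (k + 1) with h3 | h3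
    · obtain rfl := int_eq_of_lt h3 (by linarith)
      constructor <;> linarith
    · have : m = k + 1 := int_eq_of_lt (by push_cast; linarith) (by push_cast; linarith)
      rw [this] at h
      push_cast at h
      constructor <;> linarith

/-- Near every point one of the generators or of their inverses expands, with an inverse branch
that is defined on the whole cell of the image. -/
theorem IsExpanding.exists_letter (hT : T.IsExpanding) (x : ℝ) :
    ∃ s : ℝ ≃o ℝ, ∃ g ∈ RingCoding.gp T.circleGen, (∀ t : ℝ, g • (t : S1) = (s t : S1)) ∧
      ∀ y, T.lineCell y = T.lineCell (s x) →
        T.lineCell (s.symm y) = T.lineCell x ∧ |s.symm y - x| ≤ |y - s x| / 2 := by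
  have h1 := T.τ_pos
  have h2 := T.τ_lt
  rcases hx : T.lineCell x with ⟨m, b⟩
  cases b
  · refine ⟨T.gen (m : ZMod 4), T.circleGen (m : ZMod 4), RingCoding.mem_gp _, fun t => rfl,
      fun y hy => ?_⟩
    rw [lineCell_eq_false_iff] at hx
    have hu : x - m / 4 ∈ Ico 0 T.τ := ⟨by linarith, by linarith⟩
    have hu' := T.map_mem_low_iff.2 hu
    have hy' : y - m / 4 ∈ Ico 0 (T.τ + 1 / 4) := by
      refine low_of_lineCell_eq hy ?_
      rwa [gen_intCast, add_sub_cancel_right]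
    obtain ⟨w, rfl⟩ := (T.gen (m : ZMod 4)).surjective y
    rw [gen_intCast, add_sub_cancel_right, T.map_mem_low_iff] at hy'
    rw [OrderIso.symm_apply_apply]
    refine ⟨T.lineCell_eq_false_iff.2 ⟨by linarith [hy'.1], by linarith [hy'.2]⟩, ?_⟩
    have := hT.abs_low hu hy'
    rwa [gen_intCast, gen_intCast, add_sub_add_right_eq_sub, ← sub_sub_sub_cancel_right w x]
  · obtain ⟨k, rfl⟩ : ∃ k : ℤ, m = k + 1 := ⟨m - 1, by ring⟩
    refine ⟨(T.gen (k : ZMod 4)).symm, (T.circleGen (k : ZMod 4))⁻¹,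
      inv_mem (RingCoding.mem_gp _), fun t => rfl, fun y hy => ?_⟩
    rw [lineCell_eq_true_iff] at hx
    push_cast at hx
    obtain ⟨w, rfl⟩ := (T.gen (k : ZMod 4)).surjective x
    rw [OrderIso.symm_apply_apply] at hy ⊢
    change T.lineCell (T.gen (k : ZMod 4) y) = _ ∧ |T.gen (k : ZMod 4) y - _| ≤ _
    rw [gen_intCast] at hx
    have hu : w - k / 4 ∈ Ico T.τ (1 / 2) :=
      T.map_mem_high_iff.1 ⟨by linarith, by linarith⟩
    have hv := high_of_lineCell_eq hy hu
    have hv' := T.map_mem_high_iff.2 hv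
    have := hT.abs_high hu hv
    rw [gen_intCast, gen_intCast]
    refine ⟨T.lineCell_eq_true_iff.2 ⟨?_, ?_⟩, ?_⟩
    · push_cast; linarith [hv'.1]
    · push_cast; linarith [hv'.2]
    · rwa [add_sub_add_right_eq_sub, ← sub_sub_sub_cancel_right y w]

/-- Arbitrarily small neighbourhoods of every point are mapped by the group onto sets that
contain a whole cell. -/
theorem IsExpanding.exists_small (hT : T.IsExpanding) (L : ℕ) (x : ℝ) :
    ∃ g ∈ RingCoding.gp T.circleGen, ∃ p, ∀ z, T.lineCell z = p →
      ∃ y : ℝ, T.lineCell y = T.lineCell x ∧ |y - x| ≤ (1 / 2) ^ L ∧ g • (y : S1) = (z : S1) := by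
  induction L generalizing x with
  | zero =>
    refine ⟨1, one_mem _, T.lineCell x, fun z hz => ⟨z, hz, ?_, one_smul _ _⟩⟩
    have h1 := T.τ_pos
    have h2 := T.τ_lt
    rw [pow_zero, abs_le]
    rcases hm : T.lineCell x with ⟨m, b⟩
    rw [hm] at hz
    cases b
    · rw [lineCell_eq_false_iff] at hz hm
      constructor <;> linarith
    · rw [lineCell_eq_true_iff] at hz hm
      constructor <;> linarith
  | succ L ih =>
    obtain ⟨s, g, hg, hgs, hs⟩ := hT.exists_letter x
    obtain ⟨g', hg', p, hp⟩ := ih (s x)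
    refine ⟨g' * g, mul_mem hg' hg, p, fun z hz => ?_⟩
    obtain ⟨y, hy1, hy2, hy3⟩ := hp z hz
    obtain ⟨h1, h2⟩ := hs y hy1
    refine ⟨s.symm y, h1, ?_, ?_⟩
    · rw [pow_succ]; linarith
    · rw [mul_smul, hgs, OrderIso.apply_symm_apply, hy3]

theorem exists_coe_eq_of_circleCell {w : S1} {m : ℤ} {b : Bool}
    (h : T.circleCell w = ((m : ZMod 4), b)) : ∃ z : ℝ, T.lineCell z = (m, b) ∧ (z : S1) = w := by
  induction w using QuotientAddGroup.induction_on with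
  | H w =>
    obtain ⟨k, hk, hw⟩ := T.exists_lineCell_of_cell h
    obtain ⟨j, hj⟩ := (ZMod.intCast_eq_intCast_iff_dvd_sub k m 4).1 hk
    obtain rfl : m = k + 4 * j := by push_cast at hj; linarith
    refine ⟨w + j, ?_, coe_eq_coe_iff.2 ⟨-j, by push_cast; ring⟩⟩
    cases b
    · rw [lineCell_eq_false_iff] at hw ⊢
      push_cast
      constructor <;> linarith
    · rw [lineCell_eq_true_iff] at hw ⊢
      push_cast
      constructor <;> linarith

theorem IsExpanding.displaces (hT : T.IsExpanding) :
    RingCoding.Displaces T.circleGen T.circleCell := by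
  intro g _ hg1
  obtain ⟨x, hx⟩ : ∃ x : S1, g x ≠ x := by
    by_contra hcon
    push Not at hcon
    exact hg1 (Homeomorph.ext hcon)
  induction x using QuotientAddGroup.induction_on with
  | H x =>
    obtain ⟨U, V, hU, hV, hxU, hxV, hUV⟩ := t2_separation hx
    have hopen : IsOpen ((fun t : ℝ => (t : S1)) ⁻¹' (V ∩ g ⁻¹' U)) :=
      (hV.inter (hU.preimage g.continuous)).preimage (AddCircle.continuous_mk' 1)
    obtain ⟨ε, hε, hball⟩ := Metric.isOpen_iff.1 hopen x ⟨hxV, hxU⟩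
    obtain ⟨L, hL⟩ := exists_pow_lt_of_lt_one hε (by norm_num : (1 / 2 : ℝ) < 1)
    obtain ⟨k, hk, ⟨m, b⟩, hp⟩ := hT.exists_small L x
    have key : ∀ w, T.circleCell w = ((m : ZMod 4), b) → ∃ y : S1, y ∈ V ∩ g ⁻¹' U ∧
        k • y = w := by
      intro w hw
      obtain ⟨z, hz, rfl⟩ := exists_coe_eq_of_circleCell hw
      obtain ⟨y, -, hy, hyz⟩ := hp z hz
      refine ⟨y, hball ?_, hyz⟩
      rw [Metric.mem_ball, Real.dist_eq]
      exact hy.trans_lt hL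
    refine ⟨k, hk, ((m : ZMod 4), b), fun w hw hw' => ?_⟩
    obtain ⟨y, ⟨hyV, hyU⟩, rfl⟩ := key w hw
    rw [mul_smul, mul_smul, inv_smul_smul] at hw'
    obtain ⟨y', ⟨hyV', -⟩, hyy⟩ := key _ hw'
    have : y' = g y := smul_left_cancel _ hyy
    rw [this] at hyV'
    exact disjoint_left.1 hUV hyU hyV'

end RingTemplate

/-! ### A piecewise linear template in Thompson's group -/

/-- The restriction to `[0, 1]` of the piecewise linear template. -/
noncomputable def plUnit (y : ℝ) : ℝ :=
  if y ≤ 1 / 16 then 2 * y else if y ≤ 1 / 8 then 4 * y - 1 / 8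
  else if y ≤ 1 / 4 then y / 2 + 5 / 16 else if y ≤ 1 / 2 then y / 4 + 3 / 8 else y

theorem plUnit_strictMono : StrictMono plUnit := by
  intro x y hxy
  unfold plUnit
  split_ifs <;> linarith

theorem plUnit_surjective : Function.Surjective plUnit := by
  intro y
  rcases le_or_gt y (1 / 8) with h1 | h1
  · exact ⟨y / 2, by rw [plUnit, if_pos (by linarith)]; ring⟩
  rcases le_or_gt y (3 / 8) with h2 | h2
  · refine ⟨y / 4 + 1 / 32, ?_⟩
    rw [plUnit, if_neg (by linarith), if_pos (by linarith)]; ring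
  rcases le_or_gt y (7 / 16) with h3 | h3
  · refine ⟨2 * y - 5 / 8, ?_⟩
    rw [plUnit, if_neg (by linarith), if_neg (by linarith), if_pos (by linarith)]; ring
  rcases le_or_gt y (1 / 2) with h4 | h4
  · refine ⟨4 * y - 3 / 2, ?_⟩
    rw [plUnit, if_neg (by linarith), if_neg (by linarith), if_neg (by linarith),
      if_pos (by linarith)]
    ring
  · refine ⟨y, ?_⟩
    rw [plUnit, if_neg (by linarith), if_neg (by linarith), if_neg (by linarith),
      if_neg (by linarith)]

theorem plUnit_zero : plUnit 0 = 0 := by norm_num [plUnit]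

theorem plUnit_one : plUnit 1 = 1 := by norm_num [plUnit]

/-- The piecewise linear template, as a periodic function on the line. -/
noncomputable def plFun (x : ℝ) : ℝ := ⌊x⌋ + plUnit (Int.fract x)

theorem plFun_add {m : ℤ} {y : ℝ} (h0 : 0 ≤ y) (h1 : y ≤ 1) : plFun (m + y) = m + plUnit y := by
  rcases h1.eq_or_lt with rfl | h1
  · have h2 : (m : ℝ) + 1 = ((m + 1 : ℤ) : ℝ) := by push_cast; ring
    rw [plFun, h2, Int.floor_intCast, Int.fract_intCast, plUnit_zero, plUnit_one]
    push_cast; ring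
  · have h2 : ⌊(m : ℝ) + y⌋ = m := by
      rw [Int.floor_intCast_add, Int.floor_eq_zero_iff.2 ⟨h0, h1⟩, add_zero]
    rw [plFun, Int.fract, h2, add_sub_cancel_left]

theorem plFun_eq {x : ℝ} (h0 : 0 ≤ x) (h1 : x ≤ 1) : plFun x = plUnit x := by
  have := plFun_add (m := 0) h0 h1
  simpa using this

theorem plFun_strictMono : StrictMono plFun := by
  intro x y hxy
  unfold plFun
  have hx := plUnit_strictMono (Int.fract_lt_one x)
  have hy := plUnit_strictMono.monotone (Int.fract_nonneg y)
  rw [plUnit_one] at hx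
  rw [plUnit_zero] at hy
  rcases (Int.floor_mono hxy.le).eq_or_lt with h | h
  · have : Int.fract x < Int.fract y := by
      rw [Int.fract, Int.fract, h]; linarith
    have := plUnit_strictMono this
    rw [h]; linarith
  · have : ((⌊x⌋ + 1 : ℤ) : ℝ) ≤ ⌊y⌋ := by exact_mod_cast h
    push_cast at this
    linarith

theorem plFun_surjective : Function.Surjective plFun := by
  intro y
  obtain ⟨x, hx⟩ := plUnit_surjective (Int.fract y)
  have h0 : 0 ≤ x := by
    rw [← plUnit_strictMono.le_iff_le, plUnit_zero, hx]; exact Int.fract_nonneg y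
  have h1 : x ≤ 1 := by
    rw [← plUnit_strictMono.le_iff_le, plUnit_one, hx]; exact (Int.fract_lt_one y).le
  exact ⟨⌊y⌋ + x, by rw [plFun_add h0 h1, hx, Int.floor_add_fract]⟩

/-- The piecewise linear template: slopes `2, 4, 1/2, 1/4` on `[0, 1/2]`, and `τ = 1/8`. -/
noncomputable def plTemplate : RingTemplate where
  F := plFun_strictMono.orderIsoOfSurjective plFun plFun_surjective
  τ := 1 / 8
  map_add_one x := by
    simp only [StrictMono.coe_orderIsoOfSurjective, plFun, Int.floor_add_one, Int.fract_add_one]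
    push_cast; ring
  map_eq_self x hx := by
    rw [StrictMono.coe_orderIsoOfSurjective, plFun_eq (by linarith [hx.1]) hx.2]
    have := hx.1
    unfold plUnit
    split_ifs <;> linarith
  lt_map x hx := by
    obtain ⟨h1, h2⟩ := hx
    rw [StrictMono.coe_orderIsoOfSurjective, plFun_eq h1.le (by linarith)]
    unfold plUnit
    split_ifs <;> linarith
  τ_pos := by norm_num
  τ_lt := by norm_num
  map_τ := by
    rw [StrictMono.coe_orderIsoOfSurjective, plFun_eq (by norm_num) (by norm_num)]
    norm_num [plUnit]

theorem plTemplate_F (x : ℝ) : plTemplate.F x = plFun x := rfl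

theorem plTemplate_isExpanding : plTemplate.IsExpanding where
  low u v h0 h1 h2 := by
    change v < 1 / 8 at h2
    rw [plTemplate_F, plTemplate_F, plFun_eq (by linarith) (by linarith),
      plFun_eq (by linarith) (by linarith)]
    unfold plUnit
    split_ifs <;> linarith
  high u v h0 h1 h2 := by
    change 1 / 8 ≤ u at h0
    rw [plTemplate_F, plTemplate_F, plFun_eq (by linarith) (by linarith),
      plFun_eq (by linarith) (by linarith)]
    unfold plUnit
    split_ifs <;> linarith

theorem isThompsonT_plTemplate : IsThompsonT (circleHomeo plTemplate.F plTemplate.map_add_one) := by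
  refine ⟨plTemplate.F, fun t => rfl,
    (fun x : ℝ => (x : S1)) '' {0, 1 / 16, 1 / 8, 1 / 4, 1 / 2}, Set.Finite.image _ (by simp),
    ?_, ?_⟩
  · rintro _ ⟨x, hx, rfl⟩
    refine ⟨x, ?_, rfl⟩
    rcases hx with rfl | rfl | rfl | rfl | rfl
    · exact ⟨0, 0, by norm_num⟩
    · exact ⟨1, 4, by norm_num⟩
    · exact ⟨1, 3, by norm_num⟩
    · exact ⟨1, 2, by norm_num⟩
    · exact ⟨1, 1, by norm_num⟩
  intro a b hab hfree
  -- no breakpoint lies in `(a, b)`, so `[a, b]` is contained in a piece of `[m, m + 1]`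
  have hbreak : ∀ (m : ℤ) (β : ℝ), β ∈ ({0, 1 / 16, 1 / 8, 1 / 4, 1 / 2} : Set ℝ) →
      a < m + β → b ≤ m + β := by
    intro m β hβ h1
    by_contra h2
    exact hfree (m + β) ⟨h1, not_le.1 h2⟩
      ⟨β, hβ, coe_eq_coe_iff.2 ⟨m, by ring⟩⟩
  obtain ⟨m, hm⟩ : ∃ m : ℤ, m = ⌊a⌋ := ⟨_, rfl⟩
  have ha0 : (m : ℝ) ≤ a := hm ▸ Int.floor_le a
  have ha1 : a < m + 1 := hm ▸ Int.lt_floor_add_one a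
  have hint : ∀ n : ℤ, IsDyadic n := fun n => ⟨n, 0, by simp⟩
  have hpiece : ∀ (lo hi : ℝ) (n : ℤ) (d : ℝ), IsDyadic d → 0 ≤ lo → hi ≤ 1 →
      (∀ y ∈ Icc lo hi, plUnit y = (2 : ℝ) ^ n * y + d) → m + lo ≤ a → b ≤ m + hi →
      ∃ (n : ℤ) (d : ℝ), IsDyadic d ∧ ∀ t ∈ Icc a b, plTemplate.F t = (2 : ℝ) ^ n * t + d := by
    intro lo hi n d hd hlo hhi hy h1 h2
    refine ⟨n, m + d + -((2 : ℝ) ^ n * m), ((hint m).add hd).add ((hint m).zpow_mul n).neg,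
      fun t ht => ?_⟩
    have h3 := plFun_add (m := m) (y := t - m) (by linarith [ht.1]) (by linarith [ht.2])
    rw [add_sub_cancel] at h3
    rw [plTemplate_F, h3, hy _ ⟨by linarith [ht.1], by linarith [ht.2]⟩]
    ring
  have z1 : (2 : ℝ) ^ (1 : ℤ) = 2 := by norm_num
  have z2 : (2 : ℝ) ^ (2 : ℤ) = 4 := by norm_num
  have z3 : (2 : ℝ) ^ (-1 : ℤ) = 1 / 2 := by norm_num
  have z4 : (2 : ℝ) ^ (-2 : ℤ) = 1 / 4 := by norm_num
  rcases lt_or_ge a (m + 1 / 16) with h1 | h1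
  · refine hpiece 0 (1 / 16) 1 0 ⟨0, 0, by simp⟩ le_rfl (by norm_num) (fun y hy => ?_)
      (by linarith) (hbreak m _ (by simp) h1)
    rw [z1, plUnit, if_pos hy.2, add_zero]
  rcases lt_or_ge a (m + 1 / 8) with h2 | h2
  · refine hpiece (1 / 16) (1 / 8) 2 (-1 / 8) ⟨-1, 3, by norm_num⟩ (by norm_num) (by norm_num)
      (fun y hy => ?_) h1 (hbreak m _ (by simp) h2)
    have := hy.1
    have := hy.2
    rw [z2]
    unfold plUnit
    split_ifs <;> linarith
  rcases lt_or_ge a (m + 1 / 4) with h3 | h3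
  · refine hpiece (1 / 8) (1 / 4) (-1) (5 / 16) ⟨5, 4, by norm_num⟩ (by norm_num) (by norm_num)
      (fun y hy => ?_) h2 (hbreak m _ (by simp) h3)
    have := hy.1
    have := hy.2
    rw [z3]
    unfold plUnit
    split_ifs <;> linarith
  rcases lt_or_ge a (m + 1 / 2) with h4 | h4
  · refine hpiece (1 / 4) (1 / 2) (-2) (3 / 8) ⟨3, 3, by norm_num⟩ (by norm_num) (by norm_num)
      (fun y hy => ?_) h3 (hbreak m _ (by simp) h4)
    have := hy.1
    have := hy.2
    rw [z4]
    unfold plUnit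
    split_ifs <;> linarith
  · have h5 := hbreak (m + 1) 0 (by simp) (by push_cast; linarith)
    push_cast at h5
    refine hpiece (1 / 2) 1 0 0 ⟨0, 0, by simp⟩ (by norm_num) le_rfl (fun y hy => ?_) h4
      (by linarith)
    have := hy.1
    rw [zpow_zero, one_mul, add_zero]
    unfold plUnit
    split_ifs <;> linarith

theorem isThompsonT_rotation {s : ℝ} (hs : IsDyadic s) :
    IsThompsonT (circleHomeo (OrderIso.addRight s) fun x => add_right_comm x 1 s) := by
  refine ⟨OrderIso.addRight s, fun t => rfl, ∅, finite_empty, by simp, fun a b _ _ => ?_⟩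
  exact ⟨0, s, hs, fun t _ => by simp⟩

theorem circleGen_plTemplate_mem_thompsonT (i : ZMod 4) :
    plTemplate.circleGen i ∈ thompsonT := by
  set R : HomeoS1 := circleHomeo (OrderIso.addRight (i.val / 4 : ℝ))
    fun x => add_right_comm x 1 _ with hR
  have hRT : R ∈ thompsonT := isThompsonT_rotation ⟨i.val, 2, by push_cast; norm_num⟩
  have h : plTemplate.circleGen i =
      R * circleHomeo plTemplate.F plTemplate.map_add_one * R⁻¹ := by
    rw [eq_mul_inv_iff_mul_eq]
    ext x
    induction x using QuotientAddGroup.induction_on with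
    | H x =>
      change ((plTemplate.F (x + i.val / 4 + -(i.val / 4)) + i.val / 4 : ℝ) : S1) =
        ((plTemplate.F x + i.val / 4 : ℝ) : S1)
      rw [add_neg_cancel_right]
  rw [h]
  exact mul_mem (mul_mem hRT isThompsonT_plTemplate) (inv_mem hRT)

theorem IsThompsonT.isPiecewiseLinear {φ : HomeoS1} (h : IsThompsonT φ) :
    IsPiecewiseLinear φ := by
  obtain ⟨F, hF, B, hB, -, hB'⟩ := h
  refine ⟨F, F.continuous, hF, B, hB, fun a b hab hfree => ?_⟩
  obtain ⟨n, d, -, hd⟩ := hB' a b hab hfree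
  exact ⟨_, d, hd⟩


/-! ### A smooth template -/

/-- A smooth `1`-periodic function, positive over `(0, 1/2)` and zero over `[1/2, 1]`. -/
noncomputable def bump (x : ℝ) : ℝ := expNegInvGlue (Real.sin (2 * Real.pi * x))

theorem bump_add_one (x : ℝ) : bump (x + 1) = bump x := by
  rw [bump, mul_add, mul_one, Real.sin_add_two_pi, bump]

theorem bump_pos {x : ℝ} (hx : x ∈ Ioo (0 : ℝ) (1 / 2)) : 0 < bump x := by
  refine expNegInvGlue.pos_of_pos (Real.sin_pos_of_pos_of_lt_pi ?_ ?_)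
  · have := Real.pi_pos; have := hx.1; positivity
  · have := Real.pi_pos; have := hx.2; nlinarith

theorem bump_eq_zero {x : ℝ} (hx : x ∈ Icc (1 / 2 : ℝ) 1) : bump x = 0 := by
  refine expNegInvGlue.zero_of_nonpos ?_
  have h1 : Real.sin (2 * Real.pi * x) = - Real.sin (2 * Real.pi * x - Real.pi) := by
    rw [Real.sin_sub_pi, neg_neg]
  rw [h1, neg_nonpos]
  have := Real.pi_pos
  have := hx.1
  have := hx.2
  exact Real.sin_nonneg_of_nonneg_of_le_pi (by nlinarith) (by nlinarith)

theorem contDiff_bump : ContDiff ℝ ∞ bump :=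
  (expNegInvGlue.contDiff (n := ⊤)).comp (Real.contDiff_sin.comp (contDiff_const.mul contDiff_id))

/-- Only the values of `expNegInvGlue` on `[-1, 1]` enter `bump`. -/
theorem exists_deriv_bump_bound : ∃ C : ℝ, 0 ≤ C ∧ ∀ x, |deriv bump x| ≤ C := by
  have hg : ContDiff ℝ 1 expNegInvGlue := expNegInvGlue.contDiff (n := 1)
  obtain ⟨C, hC⟩ := (isCompact_Icc (a := (-1 : ℝ)) (b := 1)).exists_bound_of_continuousOn
    (hg.continuous_deriv le_rfl).continuousOn
  have hC0 : 0 ≤ C := (norm_nonneg _).trans (hC 0 (by norm_num))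
  have hpi := Real.pi_pos
  refine ⟨C * (2 * Real.pi), by positivity, fun x => ?_⟩
  have h1 : HasDerivAt (fun x : ℝ => Real.sin (2 * Real.pi * x))
      (Real.cos (2 * Real.pi * x) * (2 * Real.pi)) x := by
    have := (hasDerivAt_id x).const_mul (2 * Real.pi)
    rw [mul_one] at this
    exact this.sin
  have h2 := ((hg.differentiable one_ne_zero _).hasDerivAt).comp x h1
  have h3 : deriv bump x = _ := h2.deriv
  rw [h3, abs_mul, abs_mul, abs_of_pos (by positivity : 0 < 2 * Real.pi)]
  have h4 := hC (Real.sin (2 * Real.pi * x)) ⟨Real.neg_one_le_sin _, Real.sin_le_one _⟩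
  rw [Real.norm_eq_abs] at h4
  have h5 := Real.abs_cos_le_one (2 * Real.pi * x)
  calc _ ≤ C * (1 * (2 * Real.pi)) := by gcongr
    _ = _ := by ring

/-- An increasing homeomorphism of the line that is smooth together with its inverse. -/
def IsSmoothIso (F : ℝ ≃o ℝ) : Prop := ContDiff ℝ ∞ F ∧ ContDiff ℝ ∞ F.symm

theorem IsSmoothIso.trans {F G : ℝ ≃o ℝ} (hF : IsSmoothIso F) (hG : IsSmoothIso G) :
    IsSmoothIso (F.trans G) := ⟨hG.1.comp hF.1, hF.2.comp hG.2⟩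

theorem IsSmoothIso.pow {F : ℝ ≃o ℝ} (hF : IsSmoothIso F) (N : ℕ) : IsSmoothIso (F ^ N) := by
  induction N with
  | zero => exact ⟨contDiff_id, contDiff_id⟩
  | succ N ih => rw [pow_succ]; exact hF.trans ih

theorem isSmoothIso_addRight (s : ℝ) : IsSmoothIso (OrderIso.addRight s) := by
  refine ⟨contDiff_id.add contDiff_const, ?_⟩
  rw [OrderIso.addRight_symm]
  exact contDiff_id.add contDiff_const

/-- A smooth diffeomorphism of the line commuting with the translation by `1`, supported over
`(0, 1/2)` and moving the points of that interval to the right. -/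
theorem exists_smooth_push : ∃ F : ℝ ≃o ℝ, IsSmoothIso F ∧ (∀ x, F (x + 1) = F x + 1) ∧
    (∀ x ∈ Icc (1 / 2 : ℝ) 1, F x = x) ∧ ∀ x ∈ Ioo (0 : ℝ) (1 / 2), x < F x := by
  obtain ⟨C, hC0, hC⟩ := exists_deriv_bump_bound
  obtain ⟨ε, hε⟩ : ∃ ε : ℝ, ε = 1 / (C + 1) := ⟨_, rfl⟩
  have hε0 : 0 < ε := by rw [hε]; positivity
  have hεC : ε * C < 1 := by
    rw [hε, one_div, inv_mul_lt_iff₀ (by linarith)]; linarith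
  -- `ε` is small enough for `x + ε * bump x` to have a positive derivative
  let f : ℝ → ℝ := fun x => x + ε * bump x
  have hf : ContDiff ℝ ∞ f := contDiff_id.add (contDiff_const.mul contDiff_bump)
  have hbd : Differentiable ℝ bump := contDiff_bump.differentiable (by simp)
  have hd : ∀ x, HasDerivAt f (1 + ε * deriv bump x) x := fun x =>
    (hasDerivAt_id x).add ((hbd x).hasDerivAt.const_mul ε)
  have hpos : ∀ x, 0 < 1 + ε * deriv bump x := fun x => by
    have h1 := (abs_le.1 (hC x)).1
    have : ε * (-C) ≤ ε * deriv bump x := by gcongr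
    linarith
  have hmono : StrictMono f := strictMono_of_hasDerivAt_pos hd hpos
  have hint : ∀ n : ℤ, f n = n := fun n => by
    have : bump n = 0 := by
      have h1 := map_add_intCast (F := fun x => x + bump x)
        (fun x => by rw [bump_add_one]; ring) 1 (n - 1)
      have h2 : bump 1 = 0 := bump_eq_zero ⟨by norm_num, le_rfl⟩
      push_cast at h1
      rw [h2, show (1 : ℝ) + (n - 1) = n by ring] at h1
      linarith
    simp [f, this]
  have hsurj : Function.Surjective f := fun y => by
    have h1 : y ∈ Icc (f ⌊y⌋) (f ((⌊y⌋ + 1 : ℤ) : ℝ)) := by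
      rw [hint, hint]
      refine ⟨Int.floor_le y, ?_⟩
      push_cast
      exact (Int.lt_floor_add_one y).le
    obtain ⟨x, -, hx⟩ := intermediate_value_Icc (by push_cast; linarith) hf.continuous.continuousOn h1
    exact ⟨x, hx⟩
  let F : ℝ ≃o ℝ := hmono.orderIsoOfSurjective f hsurj
  have hF : ∀ x, F x = x + ε * bump x := fun x => rfl
  refine ⟨F, ⟨hf, ?_⟩, fun x => ?_, fun x hx => ?_, fun x hx => ?_⟩
  · exact F.toHomeomorph.contDiff_symm_deriv (fun x => (hpos x).ne') hd hf
  · rw [hF, hF, bump_add_one]; ring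
  · rw [hF, bump_eq_zero hx, mul_zero, add_zero]
  · rw [hF]
    have := mul_pos hε0 (bump_pos hx)
    linarith

/-- A homeomorphism that pushes `(0, 1/2)` to the right has a power that moves some point of
`(0, 1/4)` by exactly a quarter turn. -/
theorem exists_template_pow (F : ℝ ≃o ℝ) (h1 : ∀ x, F (x + 1) = F x + 1)
    (h2 : ∀ x ∈ Icc (1 / 2 : ℝ) 1, F x = x) (h3 : ∀ x ∈ Ioo (0 : ℝ) (1 / 2), x < F x) :
    ∃ (T : RingTemplate) (N : ℕ), T.F = F ^ N := by
  have hpow : ∀ (n : ℕ) x, (F ^ (n + 1)) x = F ((F ^ n) x) := fun n x => by rw [pow_succ']; rfl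
  have hadd : ∀ (n : ℕ) x, (F ^ n) (x + 1) = (F ^ n) x + 1 := fun n => by
    induction n with
    | zero => intro x; rfl
    | succ n ih => intro x; rw [hpow, hpow, ih, h1]
  have hself : ∀ (n : ℕ), ∀ x ∈ Icc (1 / 2 : ℝ) 1, (F ^ n) x = x := fun n => by
    induction n with
    | zero => intro x _; rfl
    | succ n ih => intro x hx; rw [hpow, ih x hx, h2 x hx]
  have hhalf : ∀ n : ℕ, ∀ x < 1 / 2, (F ^ n) x < 1 / 2 := fun n x hx => by
    have := (F ^ n).lt_iff_lt.2 hx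
    rwa [hself n (1 / 2) ⟨le_rfl, by norm_num⟩] at this
  have hle : ∀ n : ℕ, ∀ x ∈ Ioo (0 : ℝ) (1 / 2), x ≤ (F ^ n) x := fun n x hx => by
    induction n with
    | zero => exact le_rfl
    | succ n ih =>
      rw [hpow]
      exact ih.trans (h3 _ ⟨hx.1.trans_le ih, hhalf n x hx.2⟩).le
  have hlt : ∀ n : ℕ, ∀ x ∈ Ioo (0 : ℝ) (1 / 2), x < (F ^ (n + 1)) x := fun n x hx => by
    rw [hpow]
    exact (hle n x hx).trans_lt (h3 _ ⟨hx.1.trans_le (hle n x hx), hhalf n x hx.2⟩)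
  -- the displacement is bounded below on `[1/8, 3/8]`, so some power pushes `1/8` beyond `3/8`
  obtain ⟨N, hN⟩ : ∃ N : ℕ, 3 / 8 ≤ (F ^ N) (1 / 8) := by
    by_contra hcon
    push Not at hcon
    obtain ⟨x0, hx0, hmin⟩ := (isCompact_Icc (a := (1 / 8 : ℝ)) (b := 3 / 8)).exists_isMinOn
      ⟨1 / 8, by norm_num⟩ (F.continuous.sub continuous_id).continuousOn
    have hδ : 0 < F x0 - x0 :=
      sub_pos.2 (h3 x0 ⟨by linarith [hx0.1], by linarith [hx0.2]⟩)
    have hgrow : ∀ n : ℕ, 1 / 8 + n * (F x0 - x0) ≤ (F ^ n) (1 / 8) := fun n => by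
      induction n with
      | zero => simp
      | succ n ih =>
        have h4 := hle n (1 / 8) (by norm_num)
        have h5 := hmin ⟨h4, (hcon n).le⟩
        change F x0 - x0 ≤ F ((F ^ n) (1 / 8)) - (F ^ n) (1 / 8) at h5
        rw [hpow]
        push_cast
        linarith
    obtain ⟨n, hn⟩ := exists_nat_gt (1 / (F x0 - x0))
    rw [div_lt_iff₀ hδ] at hn
    linarith [hgrow n, hcon n]
  obtain ⟨M, rfl⟩ : ∃ M, N = M + 1 := by
    refine Nat.exists_eq_succ_of_ne_zero ?_
    rintro rfl
    have : (F ^ 0) (1 / 8) = (1 / 8 : ℝ) := rfl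
    rw [this] at hN
    norm_num at hN
  have hzero : (F ^ (M + 1)) 0 = 0 := by
    have h4 := hadd (M + 1) 0
    rw [zero_add, hself _ 1 ⟨by norm_num, le_rfl⟩] at h4
    linarith
  obtain ⟨τ, hτ, hτ'⟩ : ∃ τ ∈ Icc (0 : ℝ) (1 / 8), (F ^ (M + 1)) τ - τ = 1 / 4 := by
    refine intermediate_value_Icc (f := fun x => (F ^ (M + 1)) x - x) (by norm_num)
      ((F ^ (M + 1)).continuous.sub continuous_id).continuousOn ⟨?_, ?_⟩
    · rw [hzero]; norm_num
    · linarith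
  have hτ0 : τ ≠ 0 := by
    rintro rfl
    rw [hzero] at hτ'
    norm_num at hτ'
  exact ⟨{ F := F ^ (M + 1)
           τ := τ
           map_add_one := hadd _
           map_eq_self := hself _
           lt_map := hlt M
           τ_pos := lt_of_le_of_ne hτ.1 hτ0.symm
           τ_lt := by linarith [hτ.2]
           map_τ := by linarith }, M + 1, rfl⟩

theorem exists_smooth_template : ∃ T : RingTemplate, ∀ i, IsSmoothIso (T.gen i) := by
  obtain ⟨F, hF, h1, h2, h3⟩ := exists_smooth_push
  obtain ⟨T, N, hT⟩ := exists_template_pow F h1 h2 h3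
  refine ⟨T, fun i => ?_⟩
  have hTF : IsSmoothIso T.F := hT ▸ hF.pow N
  exact (isSmoothIso_addRight _).trans (hTF.trans (isSmoothIso_addRight _))

/-! ### Smooth maps of the circle from smooth lifts -/

theorem contMDiff_circle_coe : ContMDiff (𝓡 1) 𝓘(ℝ, ℂ) ∞ (fun z : Circle => (z : ℂ)) :=
  haveI : Fact (Module.finrank ℝ ℂ = 1 + 1) := Complex.finrank_real_complex_fact
  contMDiff_coe_sphere (E := ℂ) (n := 1)

theorem contDiffAt_arg {z : ℂ} (hz : z ∈ Complex.slitPlane) : ContDiffAt ℝ ∞ Complex.arg z := by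
  have h1 : ContDiffAt ℝ ∞ Complex.log z := (Complex.contDiffAt_log hz).restrict_scalars ℝ
  have h2 := Complex.imCLM.contDiff.contDiffAt.comp z h1
  refine h2.congr_of_eventuallyEq (Filter.Eventually.of_forall fun w => ?_)
  simp [Complex.log_im]

/-- A map of the unit circle with a smooth lift is smooth. -/
theorem contMDiff_of_lift {φ : Circle → Circle} {F : ℝ → ℝ} (hF : ContDiff ℝ ∞ F)
    (h : ∀ t, φ (Circle.exp t) = Circle.exp (F t)) : ContMDiff (𝓡 1) (𝓡 1) ∞ φ := by
  -- it suffices to find, near every point, a smooth choice of the angle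
  have key : ∀ (z : Circle) (a : ℂ → ℝ), ContDiffAt ℝ ∞ a z →
      (∀ w : Circle, Circle.exp (a w) = w) → ContMDiffAt (𝓡 1) (𝓡 1) ∞ φ z := by
    intro z a ha hexp
    have h1 : ContMDiffAt (𝓡 1) 𝓘(ℝ, ℝ) ∞ (fun w : Circle => F (a w)) z :=
      (hF.contDiffAt.comp (z : ℂ) ha).contMDiffAt.comp z contMDiff_circle_coe.contMDiffAt
    have h2 : ContMDiffAt (𝓡 1) (𝓡 1) ∞ (fun w : Circle => Circle.exp (F (a w))) z :=
      contMDiff_circleExp.contMDiffAt.comp z h1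
    refine h2.congr_of_eventuallyEq (Filter.Eventually.of_forall fun w => ?_)
    change φ w = Circle.exp (F (a w))
    rw [← h, hexp]
  intro z
  rcases Complex.mem_slitPlane_or_neg_mem_slitPlane z.coe_ne_zero with hz | hz
  · exact key z Complex.arg (contDiffAt_arg hz) fun w => Circle.exp_arg w
  · refine key z (fun w => Complex.arg (-w) + Real.pi) ?_ fun w => ?_
    · exact ((contDiffAt_arg hz).comp (z : ℂ) contDiffAt_id.neg).add contDiffAt_const
    · have h1 : Circle.exp (Complex.arg (-w : ℂ)) = -w := Circle.exp_arg (-w)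
      ext
      rw [Circle.exp_add, h1, Circle.coe_mul, Circle.coe_exp, Complex.exp_pi_mul_I]
      simp

/-- Conjugation by the standard identification of `ℝ / ℤ` with the unit circle. -/
noncomputable def toCircleHomeo : HomeoS1 →* (Circle ≃ₜ Circle) where
  toFun φ := (AddCircle.homeomorphCircle one_ne_zero).symm.trans
    (φ.trans (AddCircle.homeomorphCircle one_ne_zero))
  map_one' := by ext z; simp
  map_mul' φ ψ := by ext z; simp

theorem toCircleHomeo_injective : Function.Injective toCircleHomeo := by
  intro φ ψ h
  ext x
  have := DFunLike.congr_fun h (AddCircle.homeomorphCircle one_ne_zero x)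
  simpa [toCircleHomeo] using this

theorem toCircleHomeo_exp (φ : HomeoS1) (t : ℝ) (y : ℝ)
    (h : φ ((t / (2 * Real.pi) : ℝ) : S1) = (y : S1)) :
    toCircleHomeo φ (Circle.exp t) = Circle.exp (2 * Real.pi * y) := by
  have hexp : ∀ s : ℝ, AddCircle.homeomorphCircle one_ne_zero (s : S1) =
      Circle.exp (2 * Real.pi * s) := fun s => by
    rw [AddCircle.homeomorphCircle_apply, AddCircle.toCircle_apply_mk, div_one]
  have ht : Circle.exp t = AddCircle.homeomorphCircle one_ne_zero
      ((t / (2 * Real.pi) : ℝ) : S1) := by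
    rw [hexp, mul_div_cancel₀ _ (by positivity)]
  rw [ht, ← hexp, ← h]
  simp [toCircleHomeo]

theorem isSmoothDiffeo_toCircleHomeo {φ : HomeoS1} {F : ℝ ≃o ℝ} (hF : IsSmoothIso F)
    (h : ∀ t : ℝ, φ (t : S1) = (F t : S1)) : IsSmoothDiffeo (toCircleHomeo φ) := by
  have hsymm : ∀ t : ℝ, φ⁻¹ (t : S1) = (F.symm t : S1) := fun t => by
    rw [Homeomorph.inv_apply, Homeomorph.symm_apply_eq, h, OrderIso.apply_symm_apply]
  have hinv : ((toCircleHomeo φ).symm : Circle → Circle) = toCircleHomeo φ⁻¹ := by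
    rw [map_inv]; rfl
  refine ⟨contMDiff_of_lift (F := fun t => 2 * Real.pi * F (t / (2 * Real.pi))) ?_
    fun t => toCircleHomeo_exp _ _ _ (h _), ?_⟩
  · exact contDiff_const.mul (hF.1.comp (contDiff_id.div_const _))
  · rw [hinv]
    refine contMDiff_of_lift (F := fun t => 2 * Real.pi * F.symm (t / (2 * Real.pi))) ?_
      fun t => toCircleHomeo_exp _ _ _ (hsymm _)
    exact contDiff_const.mul (hF.2.comp (contDiff_id.div_const _))

/-- The smooth diffeomorphisms of the circle. -/
def smoothDiffeo : Subgroup (Circle ≃ₜ Circle) where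
  carrier := {φ | IsSmoothDiffeo φ}
  mul_mem' hφ hψ := ⟨hφ.1.comp hψ.1, hψ.2.comp hφ.2⟩
  one_mem' := ⟨contMDiff_id, contMDiff_id⟩
  inv_mem' hφ := ⟨hφ.2, hφ.1⟩

/-! ### Left orders from actions on the line -/

/-- A group acting faithfully on the line by increasing homeomorphisms is left orderable: compare
two elements at the first rational, in some enumeration, at which they differ. -/
theorem leftOrderable_of_injective {G : Type*} [Group G] (θ : G →* (ℝ ≃o ℝ))
    (hθ : Function.Injective θ) : LeftOrderable G := by
  obtain ⟨e, he⟩ := exists_surjective_nat ℚ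
  let v : G → Lex (ℕ → ℝ) := fun g => toLex fun n => θ g (e n)
  have hv : Function.Injective v := by
    intro a b hab
    refine hθ (RelIso.ext fun x => ?_)
    have hdense : DenseRange fun q : ℚ => (q : ℝ) := Rat.denseRange_cast
    refine congrFun (hdense.equalizer (θ a).continuous (θ b).continuous ?_) x
    funext q
    obtain ⟨n, rfl⟩ := he q
    exact congrFun (toLex.injective hab) n
  refine ⟨LinearOrder.lift' v hv, fun a b c hab => ?_⟩
  change v a < v b at hab
  change v (c * a) < v (c * b)
  obtain ⟨n, h1, h2⟩ := hab
  refine ⟨n, fun j hj => ?_, ?_⟩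
  · have := h1 j hj
    change θ a (e j) = θ b (e j) at this
    change θ (c * a) (e j) = θ (c * b) (e j)
    rw [map_mul, map_mul, RelIso.mul_apply, RelIso.mul_apply, this]
  · change θ a (e n) < θ b (e n) at h2
    change θ (c * a) (e n) < θ (c * b) (e n)
    rw [map_mul, map_mul, RelIso.mul_apply, RelIso.mul_apply]
    exact (θ c).lt_iff_lt.2 h2

end CircleGroups

theorem mainTheorem7 :
    ∃ (n : ℕ) (J : ZMod n → Set CircleGroups.S1) (f : ZMod n → CircleGroups.HomeoS1),
      3 ≤ n ∧ CircleGroups.IsFastRing J f ∧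
      Group.FG (CircleGroups.derivedRingGroup f) ∧
      IsSimpleGroup (CircleGroups.derivedRingGroup f) ∧
      CircleGroups.LeftOrderable (CircleGroups.derivedRingGroup f) ∧
      (∃ ρ : CircleGroups.derivedRingGroup f →* (Circle ≃ₜ Circle),
        Function.Injective ρ ∧ ∀ g, CircleGroups.IsSmoothDiffeo (ρ g)) ∧
      (∃ ρ : CircleGroups.derivedRingGroup f →* CircleGroups.HomeoS1,
        Function.Injective ρ ∧ ∀ g, CircleGroups.IsPiecewiseLinear (ρ g)) ∧
      (∃ ι : CircleGroups.derivedRingGroup f →* CircleGroups.thompsonT,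
        Function.Injective ι) := by
  open CircleGroups in
  let T := plTemplate
  have hle : derivedRingGroup T.circleGen ≤ RingCoding.gp T.circleGen :=
    Subgroup.commutator_le_self _
  have hT : derivedRingGroup T.circleGen ≤ thompsonT := by
    refine hle.trans ((Subgroup.closure_le _).2 ?_)
    rintro _ ⟨i, rfl⟩
    exact circleGen_plTemplate_mem_thompsonT i
  refine ⟨4, ringArc, T.circleGen, by norm_num, T.isFastRing, T.circleCoding.fg_derived,
    T.circleCoding.isSimpleGroup_derived plTemplate_isExpanding.displaces, ?_, ?_, ?_, ?_⟩
  · obtain ⟨θ, hθ, -⟩ := T.circleCoding.exists_injective_hom T.lineCoding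
    exact leftOrderable_of_injective (θ.comp (Subgroup.inclusion hle))
      (hθ.comp (Subgroup.inclusion_injective hle))
  · obtain ⟨T', hT'⟩ := exists_smooth_template
    obtain ⟨θ, hθ, hmem⟩ := T.circleCoding.exists_injective_hom T'.circleCoding
    refine ⟨(toCircleHomeo.comp θ).comp (Subgroup.inclusion hle),
      (toCircleHomeo_injective.comp hθ).comp (Subgroup.inclusion_injective hle), fun g => ?_⟩
    have hsub : RingCoding.gp T'.circleGen ≤ smoothDiffeo.comap toCircleHomeo := by
      refine (Subgroup.closure_le _).2 ?_
      rintro _ ⟨i, rfl⟩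
      exact isSmoothDiffeo_toCircleHomeo (hT' i) (T'.circleGen_coe i)
    exact hsub (hmem _)
  · exact ⟨Subgroup.subtype _, Subgroup.subtype_injective _,
      fun g => IsThompsonT.isPiecewiseLinear (hT g.2)⟩
  · exact ⟨Subgroup.inclusion hT, Subgroup.inclusion_injective hT⟩
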